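/- Let $(W,S)$ be a Coxeter system with length function $l$ and Bruhat order $\le$. Let $\mathcal A=\mathbb Z[q,q^{-1}]$ and let $\mathcal H$ be the associative $\mathcal A$-algebra generated by $T_s$ $(s\in S)$ with relations $T_s^2=1+(q-q^{-1})T_s$ and the braid relations $T_sT_{s'}T_s\cdots=T_{s'}T_sT_{s'}\cdots$ ($m(s,s')$ factors on each side, whenever $m(s,s')<\infty$). Let $T_w=T_{s_1}\cdots T_{s_k}$ for a reduced expression $w=s_1\cdots s_k$, and let $h\mapsto\overline h$ be the ring involution of $\mathcal H$ with $\overline q=q^{-1}$ and $\overline{T_s}=T_s^{-1}$. There are a unique $\mathcal A$-basis $(c_w\mid w\in W)$ of $\mathcal H$ and unique polynomials $q_{y,w},p_{y,w}\in\mathbb Z[q]$ $(y<w)$ such that, for all $w\in W$, $$\overline{c_w}=c_w,\qquad T_w=c_w+q\sum_{y<w}q_{y,w}c_y,\qquad c_w=T_w-q\sum_{y<w}p_{y,w}T_y .$$ Let $\mu_{y,w}$ be the constant term of $q_{y,w}$. Let $P_{y,w}$ $(y\le w)$ be the Kazhdan–Lusztig polynomials: in the traditional Hecke algebra over $\mathbb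 Z[q^{1/2},q^{-1/2}]$, with quadratic relations $T_s^2=q+(q-1)T_s$, the braid relations, and the bar involution $q^{1/2}\mapsto q^{-1/2}$, $T_s\mapsto T_s^{-1}$, they are the unique polynomials in $\mathbb Z[q]$ such that $P_{w,w}=1$, $P_{y,w}$ has degree at most $\frac12(l(w)-l(y)-1)$ if $y<w$, and for every $w$ the element $$C_w=\sum_{y\le w}(-1)^{l(w)-l(y)}q^{l(w)/2}q^{-l(y)}P_{y,w}(q^{-1})\,T_y$$ is fixed by the bar involution. (They exist and are unique.) Then for all $y<w$ in $W$ $$p_{y,w}=(-q)^{l(w)-l(y)-1}P^*_{y,w},$$ where $P^*_{y,w}$ is obtained from $P_{y,w}$ by replacing $q$ by $q^{-2}$. In particular, $\mu_{y,w}$ is also the constant term of $p_{y,w}$, and the coefficient of $q^{\frac12(l(w)-l(y)-1)}$ in $P_{y,w}$ (understood to be $0$ if the exponent is not an integer) is $(-1)^{l(w)-l(y)-1}\mu_{y,w}$. -/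

import Mathlib

open scoped LaurentPolynomial Polynomial

noncomputable section

/-! ### Hecke algebras by generators and relations -/

/-- The defining relations of the Hecke algebra with parameters `a`, `b` attached to a Coxeter
matrix `M`: `T_s ^ 2 = a T_s + b` for every `s`, and for all `s, s'` the braid relation
`⋯ T_s T_{s'} = ⋯ T_{s'} T_s` with `m(s, s')` factors on each side.
(Mathlib encodes `m(s, s') = ∞` as `M s s' = 0`; the braid relation is then the trivial `1 = 1`.) -/
inductive HeckeRel {B R : Type*} [CommRing R] (M : CoxeterMatrix B) (a b : R) :
    FreeAlgebra R B → FreeAlgebra R B → Prop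
  | quadratic (s : B) : HeckeRel M a b (FreeAlgebra.ι R s * FreeAlgebra.ι R s)
      (a • FreeAlgebra.ι R s + algebraMap R _ b)
  | braid (s s' : B) : HeckeRel M a b
      ((CoxeterSystem.braidWord M s s').map (FreeAlgebra.ι R)).prod
      ((CoxeterSystem.braidWord M s' s).map (FreeAlgebra.ι R)).prod

/-- The associative unital `R`-algebra with generators `T_s` and relations `HeckeRel M a b`. -/
def HeckeAlgebra {B R : Type*} [CommRing R] (M : CoxeterMatrix B) (a b : R) : Type _ :=
  RingQuot (HeckeRel M a b)

namespace HeckeAlgebra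

variable {B R : Type*} [CommRing R] (M : CoxeterMatrix B) (a b : R)

instance : Ring (HeckeAlgebra M a b) := inferInstanceAs (Ring (RingQuot (HeckeRel M a b)))

instance : Algebra R (HeckeAlgebra M a b) :=
  inferInstanceAs (Algebra R (RingQuot (HeckeRel M a b)))

/-- The generator `T_s`. -/
def gen (s : B) : HeckeAlgebra M a b :=
  RingQuot.mkAlgHom R (HeckeRel M a b) (FreeAlgebra.ι R s)

theorem gen_mul_gen (s : B) :
    gen M a b s * gen M a b s = a • gen M a b s + algebraMap R _ b := by
  have h := RingQuot.mkAlgHom_rel R (HeckeRel.quadratic (M := M) (a := a) (b := b) s)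
  rw [map_mul, map_add, map_smul, AlgHom.commutes] at h
  exact h

theorem gen_braid (s s' : B) :
    ((CoxeterSystem.braidWord M s s').map (gen M a b)).prod =
      ((CoxeterSystem.braidWord M s' s).map (gen M a b)).prod := by
  have h := RingQuot.mkAlgHom_rel R (HeckeRel.braid (M := M) (a := a) (b := b) s s')
  rw [map_list_prod, map_list_prod, List.map_map, List.map_map] at h
  exact h

variable {M} in
/-- The standard element `T_w = T_{s_1} ⋯ T_{s_k}`, where `w = s_1 ⋯ s_k` is a reduced
expression. (One reduced expression is chosen; the value does not depend on the choice.) -/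
def stdT {W : Type*} [Group W] (cs : CoxeterSystem M W) (w : W) : HeckeAlgebra M a b :=
  ((cs.exists_isReduced w).choose.map (gen M a b)).prod

/-! ### The bar involution -/

/-- If `b` is invertible with inverse `c`, then `T_s` is invertible with
inverse `c (T_s - a)`. -/
def genUnit (c : R) (hc : b * c = 1) (s : B) : (HeckeAlgebra M a b)ˣ where
  val := gen M a b s
  inv := c • (gen M a b s - algebraMap R _ a)
  val_inv := by
    rw [mul_smul_comm, mul_sub, gen_mul_gen, ← Algebra.commutes, ← Algebra.smul_def,
      add_sub_cancel_left, Algebra.smul_def, ← map_mul, mul_comm, hc, map_one]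
  inv_val := by
    rw [smul_mul_assoc, sub_mul, gen_mul_gen, ← Algebra.smul_def, add_sub_cancel_left,
      Algebra.smul_def, ← map_mul, mul_comm, hc, map_one]

theorem reverse_alternatingWord (s s' : B) (m : ℕ) :
    (CoxeterSystem.alternatingWord s s' m).reverse =
      if Even m then CoxeterSystem.alternatingWord s' s m
      else CoxeterSystem.alternatingWord s s' m := by
  induction m generalizing s s' with
  | zero => simp [CoxeterSystem.alternatingWord]
  | succ m ih =>
    rw [CoxeterSystem.alternatingWord_succ, List.concat_eq_append, List.reverse_append, ih,
      ← List.concat_eq_append, ← CoxeterSystem.alternatingWord_succ,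
      CoxeterSystem.alternatingWord_succ' s' s, CoxeterSystem.alternatingWord_succ' s s']
    by_cases h : Even m <;> simp [h, Nat.even_add_one]

theorem genUnit_inv_braid (c : R) (hc : b * c = 1) (s s' : B) :
    ((CoxeterSystem.braidWord M s s').map
        (fun t => (((genUnit M a b c hc t)⁻¹ : (HeckeAlgebra M a b)ˣ) : HeckeAlgebra M a b))).prod =
      ((CoxeterSystem.braidWord M s' s).map
        (fun t => (((genUnit M a b c hc t)⁻¹ : (HeckeAlgebra M a b)ˣ) :
          HeckeAlgebra M a b))).prod := by
  have hU : ((CoxeterSystem.braidWord M s s').map (genUnit M a b c hc)).prod =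
      ((CoxeterSystem.braidWord M s' s).map (genUnit M a b c hc)).prod := by
    have h := gen_braid M a b s s'
    ext
    rw [← Units.coeHom_apply, ← Units.coeHom_apply, map_list_prod, map_list_prod, List.map_map,
      List.map_map]
    exact h
  have hinv : ∀ L : List B, (L.map (fun t => (genUnit M a b c hc t)⁻¹)).prod =
      ((L.reverse.map (genUnit M a b c hc)).prod)⁻¹ := by
    intro L
    rw [List.prod_inv_reverse, List.map_map, ← List.map_reverse, List.reverse_reverse]
    rfl
  have hV : ((CoxeterSystem.braidWord M s s').map (fun t => (genUnit M a b c hc t)⁻¹)).prod =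
      ((CoxeterSystem.braidWord M s' s).map (fun t => (genUnit M a b c hc t)⁻¹)).prod := by
    rw [hinv, hinv, inv_inj]
    unfold CoxeterSystem.braidWord at hU ⊢
    rw [M.symmetric s' s] at hU ⊢
    rw [reverse_alternatingWord, reverse_alternatingWord]
    split_ifs
    · exact hU.symm
    · exact hU
  have h := congrArg (Units.coeHom (HeckeAlgebra M a b)) hV
  rw [map_list_prod, map_list_prod, List.map_map, List.map_map] at h
  exact h

/-- The ring `HeckeAlgebra M a b`, made an `R`-algebra through a ring endomorphism `σ` of `R`:
`r` acts as `σ r`. -/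
def Twist (_σ : R →+* R) : Type _ := HeckeAlgebra M a b

instance (σ : R →+* R) : Ring (Twist M a b σ) := inferInstanceAs (Ring (HeckeAlgebra M a b))

instance (σ : R →+* R) : Algebra R (Twist M a b σ) :=
  RingHom.toAlgebra' (S := HeckeAlgebra M a b) ((algebraMap R (HeckeAlgebra M a b)).comp σ)
    (fun r x => Algebra.commutes (σ r) x)

theorem algebraMap_twist (σ : R →+* R) (r : R) :
    algebraMap R (Twist M a b σ) r = algebraMap R (HeckeAlgebra M a b) (σ r) := rfl

/-- `T_s⁻¹`, as an element of the twisted algebra. -/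
def genInv (σ : R →+* R) (hb : b * σ b = 1) (s : B) : Twist M a b σ :=
  (((genUnit M a b (σ b) hb s)⁻¹ : (HeckeAlgebra M a b)ˣ) : HeckeAlgebra M a b)

theorem lift_respects (σ : R →+* R) (hb : b * σ b = 1) (ha : σ a = -(a * σ b))
    ⦃x y : FreeAlgebra R B⦄ (h : HeckeRel M a b x y) :
    FreeAlgebra.lift R (genInv M a b σ hb) x = FreeAlgebra.lift R (genInv M a b σ hb) y := by
  cases h with
  | quadratic s =>
    rw [map_mul, map_add, map_smul, AlgHom.commutes, FreeAlgebra.lift_ι_apply,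
      Algebra.smul_def, algebraMap_twist, algebraMap_twist]
    change (σ b • (gen M a b s - algebraMap R _ a)) * (σ b • (gen M a b s - algebraMap R _ a)) =
      algebraMap R (HeckeAlgebra M a b) (σ a) * (σ b • (gen M a b s - algebraMap R _ a)) +
        algebraMap R (HeckeAlgebra M a b) (σ b)
    have h1 : (gen M a b s - algebraMap R _ a) * (gen M a b s - algebraMap R _ a) =
        algebraMap R _ b - a • (gen M a b s - algebraMap R _ a) := by
      rw [sub_mul, mul_sub, mul_sub, gen_mul_gen, ← Algebra.commutes, ← Algebra.smul_def, smul_sub,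
        Algebra.smul_def, Algebra.smul_def]
      abel
    rw [smul_mul_smul_comm, h1, ← Algebra.smul_def, smul_smul, ha, smul_sub, smul_smul,
      Algebra.smul_def (σ b * σ b) (algebraMap R _ b), ← map_mul,
      show σ b * σ b * b = σ b by rw [mul_assoc, mul_comm (σ b) b, hb, mul_one],
      show -(a * σ b) * σ b = -(σ b * σ b * a) by ring, neg_smul]
    abel
  | braid s s' =>
    rw [map_list_prod, map_list_prod, List.map_map, List.map_map]
    simp only [Function.comp_def, FreeAlgebra.lift_ι_apply]
    exact genUnit_inv_braid M a b (σ b) hb s s'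

/-- The bar map: the ring endomorphism with `r T_s ↦ σ(r) T_s⁻¹` for `r` in `R`, where `σ` is an
endomorphism of `R` compatible with the parameters. -/
def bar (σ : R →+* R) (hb : b * σ b = 1) (ha : σ a = -(a * σ b)) :
    HeckeAlgebra M a b →+* HeckeAlgebra M a b :=
  (RingQuot.liftAlgHom R (B := Twist M a b σ)
    ⟨FreeAlgebra.lift R (genInv M a b σ hb), lift_respects M a b σ hb ha⟩).toRingHom

theorem bar_gen (σ : R →+* R) (hb : b * σ b = 1) (ha : σ a = -(a * σ b)) (s : B) :
    bar M a b σ hb ha (gen M a b s) = (((genUnit M a b (σ b) hb s)⁻¹ : (HeckeAlgebra M a b)ˣ) :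
      HeckeAlgebra M a b) := by
  refine (RingQuot.liftAlgHom_mkAlgHom_apply R (FreeAlgebra.lift R (genInv M a b σ hb))
    (lift_respects M a b σ hb ha) (FreeAlgebra.ι R s)).trans ?_
  rw [FreeAlgebra.lift_ι_apply]
  rfl

theorem bar_smul (σ : R →+* R) (hb : b * σ b = 1) (ha : σ a = -(a * σ b)) (r : R)
    (x : HeckeAlgebra M a b) : bar M a b σ hb ha (r • x) = σ r • bar M a b σ hb ha x := by
  rw [Algebra.smul_def, Algebra.smul_def, map_mul]
  congr 1
  exact AlgHom.commutes (RingQuot.liftAlgHom R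
    ⟨FreeAlgebra.lift R (genInv M a b σ hb), lift_respects M a b σ hb ha⟩) r

end HeckeAlgebra

/-- The involution of `ℤ[q, q⁻¹]` with `q ↦ q⁻¹`. -/
def laurentBar : ℤ[T;T⁻¹] →+* ℤ[T;T⁻¹] :=
  RingHomClass.toRingHom (LaurentPolynomial.invert : ℤ[T;T⁻¹] ≃ₐ[ℤ] ℤ[T;T⁻¹])

theorem laurentBar_T (n : ℤ) :
    laurentBar (LaurentPolynomial.T n) = LaurentPolynomial.T (-n) :=
  LaurentPolynomial.invert_T n

/-! ### The Bruhat order -/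

namespace CoxeterSystem

variable {B W : Type*} [Group W] {M : CoxeterMatrix B} (cs : CoxeterSystem M W)

/-- The Bruhat order: the transitive closure of the relation
`ℓ(u) ≤ ℓ(w)` and `w = t u` for a reflection `t` or `t = 1`. -/
def BruhatLE : W → W → Prop :=
  Relation.TransGen fun u w =>
    cs.length u ≤ cs.length w ∧ ∃ t, (cs.IsReflection t ∨ t = 1) ∧ w = t * u

/-- The strict Bruhat order. -/
def BruhatLT (u w : W) : Prop := cs.BruhatLE u w ∧ u ≠ w

/-! ### The normalized Hecke algebra and its canonical basis -/

/-- The Hecke algebra `ℋ` over `ℤ[q, q⁻¹]`, with quadratic relations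
`T_s ^ 2 = (q - q⁻¹) T_s + 1`. Here `q` is `LaurentPolynomial.T 1`. -/
abbrev NHecke (M : CoxeterMatrix B) : Type _ :=
  HeckeAlgebra (R := ℤ[T;T⁻¹]) M (LaurentPolynomial.T 1 - LaurentPolynomial.T (-1)) 1

/-- The standard element `T_w` of `ℋ`. -/
abbrev nT (w : W) : NHecke M := HeckeAlgebra.stdT _ _ cs w

/-- The bar involution of `ℋ`: `q ↦ q⁻¹`, `T_s ↦ T_s⁻¹ = T_s - (q - q⁻¹)`. -/
def nBar (M : CoxeterMatrix B) : NHecke M →+* NHecke M :=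
  HeckeAlgebra.bar M _ _ laurentBar
    (by rw [map_one, mul_one])
    (by rw [map_one, mul_one, map_sub, laurentBar_T, laurentBar_T, neg_neg, neg_sub])

/-- `c` is an `ℤ[q, q⁻¹]`-basis of `ℋ` which, with polynomials `Q w y = q_{y,w}` and
`p w y = p_{y,w}` in `ℤ[q]` (given for `y < w`, and `0` otherwise), satisfies
`bar c_w = c_w`, `T_w = c_w + q ∑_{y < w} q_{y,w} c_y` and `c_w = T_w - q ∑_{y < w} p_{y,w} T_y`. -/
structure IsCanonicalBasis (c : Module.Basis W ℤ[T;T⁻¹] (NHecke M)) (Q p : W → W →₀ ℤ[X]) : Prop where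
  bar_eq : ∀ w, nBar M (c w) = c w
  Q_eq_zero : ∀ y w, ¬ cs.BruhatLT y w → Q w y = 0
  p_eq_zero : ∀ y w, ¬ cs.BruhatLT y w → p w y = 0
  T_eq : ∀ w, cs.nT w = c w +
    (LaurentPolynomial.T 1 : ℤ[T;T⁻¹]) • (Q w).sum fun y f => Polynomial.toLaurent f • c y
  c_eq : ∀ w, c w = cs.nT w -
    (LaurentPolynomial.T 1 : ℤ[T;T⁻¹]) • (p w).sum fun y f => Polynomial.toLaurent f • cs.nT y

/-! ### The traditional Hecke algebra and the Kazhdan-Lusztig polynomials -/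

/-- The Hecke algebra in its traditional form, over `ℤ[v, v⁻¹]` with `v = q ^ (1/2)`
(so `v` is `LaurentPolynomial.T 1` and `q` is `LaurentPolynomial.T 2`), with quadratic relations
`T_s ^ 2 = (q - 1) T_s + q`. -/
abbrev KLHecke (M : CoxeterMatrix B) : Type _ :=
  HeckeAlgebra (R := ℤ[T;T⁻¹]) M (LaurentPolynomial.T 2 - 1) (LaurentPolynomial.T 2)

/-- The standard element `T_w` of the traditional Hecke algebra. -/
abbrev klT (w : W) : KLHecke M := HeckeAlgebra.stdT _ _ cs w

/-- The bar involution of the traditional Hecke algebra: `q ^ (1/2) ↦ q ^ (-1/2)`,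
`T_s ↦ T_s⁻¹`. -/
def klBar (M : CoxeterMatrix B) : KLHecke M →+* KLHecke M :=
  HeckeAlgebra.bar M _ _ laurentBar
    (by rw [laurentBar_T, ← LaurentPolynomial.T_add, add_neg_cancel, LaurentPolynomial.T_zero])
    (by rw [map_sub, map_one, laurentBar_T, sub_mul, one_mul, ← LaurentPolynomial.T_add,
      add_neg_cancel, LaurentPolynomial.T_zero, neg_sub])

/-- `P w y = P_{y,w}` are the Kazhdan-Lusztig polynomials (in the variable `q`): `P_{w,w} = 1`,
`P_{y,w} = 0` unless `y ≤ w`, `P_{y,w}` has degree at most `(ℓ(w) - ℓ(y) - 1) / 2` if `y < w`, and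
`C_w = ∑_{y ≤ w} (-1) ^ (ℓ(w) - ℓ(y)) q ^ (ℓ(w) / 2) q ^ (-ℓ(y)) P_{y,w}(q⁻¹) T_y`
is fixed by the bar involution of the traditional Hecke algebra. -/
structure IsKLFamily (P : W → W →₀ ℤ[X]) : Prop where
  diag : ∀ w, P w w = 1
  eq_zero : ∀ y w, ¬ cs.BruhatLE y w → P w y = 0
  degree_le : ∀ y w, cs.BruhatLT y w →
    2 * (P w y).natDegree + 1 + cs.length y ≤ cs.length w
  bar_eq : ∀ w,
    klBar M ((P w).sum fun y f =>
        ((-1) ^ (cs.length w - cs.length y) *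
          LaurentPolynomial.T ((cs.length w : ℤ) - 2 * cs.length y) *
          Polynomial.aeval (LaurentPolynomial.T (-2) : ℤ[T;T⁻¹]) f) • cs.klT y) =
      (P w).sum fun y f =>
        ((-1) ^ (cs.length w - cs.length y) *
          LaurentPolynomial.T ((cs.length w : ℤ) - 2 * cs.length y) *
          Polynomial.aeval (LaurentPolynomial.T (-2) : ℤ[T;T⁻¹]) f) • cs.klT y

end CoxeterSystem

end

/-! Put $v = q^{1/2}$. The homomorphism $T_s \mapsto vT_s$ from the traditional Hecke algebra to
$\mathcal H$, with $v$ becoming the variable $q$ of $\mathcal H$, commutes with the bar involutions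
(`klToN_klBar`) and is injective. It sends $C_w$ to $\sum_y (-1)^{l(w)-l(y)} q^{l(w)-l(y)}
P_{y,w}(q^{-2})\, T_y$. The degree bound on $P_{y,w}$ says exactly that only positive powers of $q$
occur here for $y<w$. So the image is fixed by bar and lies in $T_w+q\sum_y\mathbb Z[q]T_y$. Only
$c_w$ has these two properties, and comparing coefficients of $T_y$ gives the formula for $p_{y,w}$
(`IsKLFamily.klToN_klElement`, `IsKLFamily.toLaurent_eq`).

Uniqueness of $c_w$ holds because bar is unitriangular for the length: a bar-fixed element whose
coefficients have only positive powers of $q$ is zero (`eq_zero_of_nBar_eq`). For existence, take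
$w=su>u$, form $(T_s-q)c_u$, and subtract integer multiples of shorter $c_v$ to remove the unwanted
constant terms (`exists_isCanonicalStrong`). The induction also carries the Bruhat support, the
bound $j\le l(w)-l(y)$ for an exponent $j$ at $T_y$, and the parity of $l(w)-l(y)-j$. These allow
polynomials $P_{y,w}$ to be read off from $c_w$, which gives existence of the Kazhdan–Lusztig
family. The two constant terms agree because $c_v\equiv T_v$ modulo $q$.

All this needs $(T_w)$ to be a well-defined basis. Well-definedness is Matsumoto's theorem
(`prod_map_eq_of_isReduced`), proved from strong exchange and from the exact order of $ss'$, which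
the geometric representation supplies. Linear independence comes from the action on the free module
on $W$ (`regularRep`). -/

noncomputable section

/-! ### The geometric representation and the order of a product of two simple reflections. -/

namespace CoxeterMatrix

open Real Polynomial.Chebyshev

variable {B : Type*} (M : CoxeterMatrix B)

/-- The linear form `2 ⟨α_i, ·⟩` of the geometric representation of `M`. -/
def geomCoroot (i : B) : Module.Dual ℝ (B →₀ ℝ) :=
  Finsupp.linearCombination ℝ fun j => -2 * cos (π / M i j)

theorem geomCoroot_single (i j : B) :
    M.geomCoroot i (Finsupp.single j 1) = -2 * cos (π / M i j) := by
  simp [geomCoroot]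

theorem geomCoroot_self (i : B) : M.geomCoroot i (Finsupp.single i 1) = 2 := by
  simp [geomCoroot_single]

/-- The simple reflections of the geometric representation of `M`. -/
def geomReflection (i : B) : (B →₀ ℝ) ≃ₗ[ℝ] (B →₀ ℝ) :=
  Module.reflection (M.geomCoroot_self i)

theorem geomCoroot_mul (i j : B) :
    2 * cos (2 * (π / M i j)) = M.geomCoroot i (Finsupp.single j 1) *
      M.geomCoroot j (Finsupp.single i 1) - 2 := by
  rw [geomCoroot_single, geomCoroot_single, M.symmetric j i, cos_two_mul]
  ring

theorem sin_two_pi_div_pos {m : ℕ} (hm : 3 ≤ m) : 0 < sin (2 * (π / m)) := by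
  have hm' : (3 : ℝ) ≤ m := by exact_mod_cast hm
  apply sin_pos_of_pos_of_lt_pi
  · positivity
  · rw [← mul_div_assoc, div_lt_iff₀ (by linarith)]
    nlinarith [pi_pos]

theorem S_eval_two_mul_cos_eq_zero {k : ℤ} {θ : ℝ} (hθ : sin θ ≠ 0) (h : sin ((k + 1) * θ) = 0) :
    (S ℝ k).eval (2 * cos θ) = 0 := by
  have := S_two_mul_real_cos θ k
  rw [h] at this
  exact (mul_eq_zero.mp this).resolve_right hθ

/-- Powers of a product of two reflections have coefficients in the Chebyshev polynomials $S_k$ at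
$2\cos\theta$, $\theta = 2\pi/m$, where $S_k(2\cos\theta)\sin\theta=\sin((k+1)\theta)$. At the power
$m$ a common factor vanishes: $S_{k-1}$ if $m=2k$, and $S_k+S_{k-1}$ if $m=2k+1$. -/
theorem geomReflection_isLiftable : M.IsLiftable M.geomReflection := by
  intro i j
  rcases eq_or_ne i j with rfl | hij
  · rw [M.diagonal, pow_one]
    ext1 z
    exact Module.involutive_reflection (M.geomCoroot_self i) z
  have h1 := M.off_diagonal i j hij
  apply LinearEquiv.ext
  intro z
  rw [geomReflection, geomReflection, Module.reflection_mul_reflection_pow_apply _ _ _ _ _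
    (M.geomCoroot_mul i j), LinearEquiv.coe_one, id]
  obtain h0 | h2 | h3 : M i j = 0 ∨ M i j = 2 ∨ 3 ≤ M i j := by omega
  · simp [h0]
  -- The case $m=2$ is separate because $\sin\theta=\sin\pi=0$ cannot be cancelled.
  · have hf : M.geomCoroot i (Finsupp.single j 1) = 0 := by simp [geomCoroot_single, h2]
    have hg : M.geomCoroot j (Finsupp.single i 1) = 0 := by
      simp [geomCoroot_single, M.symmetric j i, h2]
    have ht : 2 * cos (2 * (π / (2 : ℕ))) = -2 := by
      rw [show 2 * (π / (2 : ℕ)) = π by push_cast; ring]; simp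
    rw [hf, hg, h2, ht]
    norm_num
    module
  · have hs := (sin_two_pi_div_pos h3).ne'
    have hm : (M i j : ℝ) ≠ 0 := by positivity
    obtain ⟨k, hk⟩ := Nat.even_or_odd' (M i j)
    rcases hk with hk | hk
    · have e1 : ((M i j : ℤ) - 2) / 2 = k - 1 := by omega
      have e2 : ((M i j : ℤ) - 1) / 2 = k - 1 := by omega
      have hS : (S ℝ (k - 1)).eval (2 * cos (2 * (π / M i j))) = 0 := by
        apply S_eval_two_mul_cos_eq_zero hs
        rw [show (((k - 1 : ℤ) : ℝ) + 1) * (2 * (π / M i j)) = π by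
          have : (M i j : ℝ) = 2 * k := by exact_mod_cast hk
          push_cast; field_simp; linarith]
        exact sin_pi
      rw [e1, e2, hS]
      simp
    · have e1 : ((M i j : ℤ) - 2) / 2 = k - 1 := by omega
      have e2 : ((M i j : ℤ) - 1) / 2 = k := by omega
      have e3 : ((M i j : ℤ) - 3) / 2 = k - 1 := by omega
      have e4 : ((M i j : ℤ)) / 2 = k := by omega
      have hS : (S ℝ k).eval (2 * cos (2 * (π / M i j))) +
          (S ℝ (k - 1)).eval (2 * cos (2 * (π / M i j))) = 0 := by
        refine (mul_eq_zero.mp ?_).resolve_right hs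
        rw [add_mul, S_two_mul_real_cos, S_two_mul_real_cos]
        have : (M i j : ℝ) = 2 * k + 1 := by exact_mod_cast hk
        rw [show (((k : ℤ) : ℝ) + 1) * (2 * (π / M i j)) = π + π / M i j by
            push_cast; field_simp; linarith,
          show (((k - 1 : ℤ) : ℝ) + 1) * (2 * (π / M i j)) = π - π / M i j by
            push_cast; field_simp; linarith]
        rw [sin_add, sin_sub]
        simp
      rw [e1, e2, e3, e4, hS]
      simp

/-- If the power fixed $\alpha_i$, its $\alpha_j$-coordinate would give $S_{k-1}=0$ and then its
$\alpha_i$-coordinate $S_k=1$. Hence $\cos k\theta=1$ with $0<k\theta<2\pi$, which is impossible. -/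
theorem geomReflection_mul_pow_ne_one {i j : B} (hij : i ≠ j) {k : ℕ} (hk : 0 < k)
    (hkm : M i j ≠ 0 → k < M i j) : (M.geomReflection i * M.geomReflection j) ^ k ≠ 1 := by
  intro h
  have hx := LinearEquiv.congr_fun h (Finsupp.single i 1)
  rw [geomReflection, geomReflection, Module.reflection_mul_reflection_pow_apply_self _ _ _ _
    (M.geomCoroot_mul i j)] at hx
  have hi := DFunLike.congr_fun hx i
  have hj := DFunLike.congr_fun hx j
  simp [hij, hij.symm, geomCoroot_single] at hi hj
  have h1 := M.off_diagonal i j hij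
  obtain h0 | h2 | h3 : M i j = 0 ∨ M i j = 2 ∨ 3 ≤ M i j := by omega
  -- For $m=\infty$, encoded as $0$, the convention $\pi/0=0$ gives the usual entry $-2$, and
  -- $S_{k-1}(2)=k\ne0$.
  · rw [M.symmetric j i, h0] at hj
    simp at hj
    omega
  · have ht : 2 * cos (2 * (π / (2 : ℕ))) = -2 := by
      rw [show 2 * (π / (2 : ℕ)) = π by push_cast; ring]; simp
    have : k = 1 := by have := hkm (by omega); omega
    rw [h2, ht, this] at hi
    norm_num at hi
  · have hs := (sin_two_pi_div_pos h3).ne'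
    have hm : (3 : ℝ) ≤ M i j := by exact_mod_cast h3
    have hc : cos (π / M j i) ≠ 0 := by
      rw [M.symmetric j i]
      apply ne_of_gt
      apply cos_pos_of_mem_Ioo
      constructor
      · have : 0 < π / M i j := by positivity
        linarith [pi_pos]
      · apply div_lt_div_of_pos_left pi_pos <;> linarith
    have hS := hj.resolve_right hc
    rw [hS, add_zero] at hi
    have a1 := S_two_mul_real_cos (2 * (π / M i j)) k
    have a2 := S_two_mul_real_cos (2 * (π / M i j)) (k - 1)
    rw [hi] at a1
    rw [hS] at a2
    have a3 : sin (k * (2 * (π / M i j))) = 0 := by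
      rw [zero_mul] at a2; rw [a2]; push_cast; congr 1; ring
    rw [show (((k : ℤ) : ℝ) + 1) * (2 * (π / M i j)) = k * (2 * (π / M i j)) + 2 * (π / M i j) by
      push_cast; ring, sin_add, a3, zero_mul, zero_add] at a1
    have a4 : cos (k * (2 * (π / M i j))) = 1 := by
      apply mul_right_cancel₀ hs; linarith
    have hkm' : (k : ℝ) < M i j := by exact_mod_cast hkm (by omega)
    have hkp : (0 : ℝ) < k := by exact_mod_cast hk
    have hpos : 0 < k * (2 * (π / M i j)) := by positivity
    rw [cos_eq_one_iff_of_lt_of_lt (by linarith [pi_pos])] at a4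
    · linarith
    · rw [show k * (2 * (π / M i j)) = 2 * π * (k / M i j) by ring]
      have : (k : ℝ) / M i j < 1 := (div_lt_one (by linarith)).mpr hkm'
      nlinarith [pi_pos]

end CoxeterMatrix

namespace CoxeterSystem

variable {B W : Type*} [Group W] {M : CoxeterMatrix B} (cs : CoxeterSystem M W)

theorem simple_mul_simple_pow_ne_one {i j : B} (hij : i ≠ j) {k : ℕ} (hk : 0 < k)
    (hkm : M i j ≠ 0 → k < M i j) : (cs.simple i * cs.simple j) ^ k ≠ 1 := by
  intro h
  have := congrArg (cs.lift ⟨_, M.geomReflection_isLiftable⟩) h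
  rw [map_pow, map_mul, lift_apply_simple, lift_apply_simple, map_one] at this
  exact M.geomReflection_mul_pow_ne_one hij hk hkm this

end CoxeterSystem

namespace CoxeterSystem

open List

variable {B W : Type*} [Group W] {M : CoxeterMatrix B} (cs : CoxeterSystem M W)

/-! ### The parity of inversions and the strong exchange condition -/

open scoped Classical in
/-- The action of a simple reflection `s` on `W × ℤ/2`: `(t, ε) ↦ (s t s, ε + [t = s])`. -/
def signedConj (i : B) : Equiv.Perm (W × ZMod 2) where
  toFun p := (cs.simple i * p.1 * cs.simple i, p.2 + if p.1 = cs.simple i then 1 else 0)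
  invFun p := (cs.simple i * p.1 * cs.simple i, p.2 + if p.1 = cs.simple i then 1 else 0)
  left_inv p := by
    ext
    · simp [mul_assoc]
    · have : cs.simple i * p.1 * cs.simple i = cs.simple i ↔ p.1 = cs.simple i := by
        rw [mul_eq_right, mul_eq_one_iff_eq_inv', inv_simple]
      simp only [this, add_assoc, CharTwo.add_self_eq_zero, add_zero]
  right_inv p := by
    ext
    · simp [mul_assoc]
    · have : cs.simple i * p.1 * cs.simple i = cs.simple i ↔ p.1 = cs.simple i := by
        rw [mul_eq_right, mul_eq_one_iff_eq_inv', inv_simple]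
      simp only [this, add_assoc, CharTwo.add_self_eq_zero, add_zero]

-- A letter flips the sign exactly when the current conjugate of $t$ equals it, that is, when $t$ is
-- the corresponding entry of the right inversion sequence.
open scoped Classical in
theorem prod_map_signedConj_apply (ω : List B) (t : W) (ε : ZMod 2) :
    (ω.map cs.signedConj).prod (t, ε) =
      (cs.wordProd ω * t * (cs.wordProd ω)⁻¹, ε + ((cs.rightInvSeq ω).count t : ℕ)) := by
  induction ω with
  | nil => simp
  | cons i ω ih =>
    rw [map_cons, prod_cons, Equiv.Perm.mul_apply, ih]
    ext
    · simp [signedConj, wordProd_cons, mul_assoc]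
    · have : cs.wordProd ω * t * (cs.wordProd ω)⁻¹ = cs.simple i ↔
          (cs.wordProd ω)⁻¹ * cs.simple i * cs.wordProd ω = t := by
        rw [mul_inv_eq_iff_eq_mul, mul_assoc, inv_mul_eq_iff_eq_mul, eq_comm]
      simp only [signedConj, Equiv.coe_fn_mk, this, rightInvSeq, count_cons, beq_iff_eq]
      push_cast
      rw [add_assoc]

-- The inversion sequence is periodic with period $m$, since shifting by $m$ inserts a factor
-- $(ss')^m=1$. Its two halves coincide. This is what makes the signed action respect the Coxeter
-- relations.
open scoped Classical in
theorem even_count_rightInvSeq_alternatingWord (i j : B) (t : W) :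
    Even ((cs.rightInvSeq (alternatingWord i j (2 * M i j))).count t) := by
  have hr : alternatingWord i j (2 * M i j) = (alternatingWord j i (2 * M i j)).reverse := by
    rw [HeckeAlgebra.reverse_alternatingWord, if_pos (even_two_mul _)]
  rw [hr, rightInvSeq_reverse, count_reverse]
  set L := cs.leftInvSeq (alternatingWord j i (2 * M i j)) with hL
  have hlen : L.length = 2 * M i j := by simp [hL]
  have h : L.take (M i j) = L.drop (M i j) := by
    apply ext_getElem
    · simp [hlen]; omega
    · intro k h1 h2
      simp only [length_take, length_drop, hlen] at h1 h2
      rw [getElem_take, getElem_drop]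
      simp only [hL]
      rw [getElem_leftInvSeq_alternatingWord _ _ _ _ _ (by omega),
        getElem_leftInvSeq_alternatingWord _ _ _ _ _ (by omega),
        prod_alternatingWord_eq_mul_pow, prod_alternatingWord_eq_mul_pow]
      rw [show (2 * k + 1) / 2 = k by omega,
        show (2 * (M i j + k) + 1) / 2 = M i j + k by omega, pow_add, simple_mul_simple_pow]
      simp [parity_simps]
  rw [← take_append_drop (M i j) L, count_append, ← h]
  exact Even.add_self _

theorem signedConj_isLiftable : M.IsLiftable cs.signedConj := by
  classical
  intro i j
  have key : ∀ m, (cs.signedConj i * cs.signedConj j) ^ m =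
      ((alternatingWord i j (2 * m)).map cs.signedConj).prod := by
    intro m
    induction m with
    | zero => simp [alternatingWord]
    | succ m ih =>
      rw [pow_succ', ih, show 2 * (m + 1) = 2 * m + 1 + 1 by ring, alternatingWord_succ',
        alternatingWord_succ']
      simp [parity_simps, mul_assoc]
  ext1 ⟨t, ε⟩
  rw [key, prod_map_signedConj_apply, prod_alternatingWord_eq_mul_pow, if_pos (even_two_mul _),
    Nat.mul_div_cancel_left _ two_pos, simple_mul_simple_pow,
    (ZMod.natCast_eq_zero_iff_even).mpr (cs.even_count_rightInvSeq_alternatingWord i j t)]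
  simp

/-- The parity of the number of occurrences of `t` in the left inversion sequence of any
word for `w`. -/
def invParity (w t : W) : ZMod 2 :=
  (cs.lift ⟨_, cs.signedConj_isLiftable⟩ w⁻¹ (t, 0)).2

open scoped Classical in
theorem lift_signedConj_wordProd (ω : List B) (t : W) (ε : ZMod 2) :
    cs.lift ⟨_, cs.signedConj_isLiftable⟩ (cs.wordProd ω) (t, ε) =
      (cs.wordProd ω * t * (cs.wordProd ω)⁻¹, ε + ((cs.rightInvSeq ω).count t : ℕ)) := by
  rw [← prod_map_signedConj_apply, wordProd, map_list_prod, map_map]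
  congr 3
  ext1 i
  exact cs.lift_apply_simple _ i

open scoped Classical in
theorem invParity_wordProd (ω : List B) (t : W) :
    cs.invParity (cs.wordProd ω) t = ((cs.leftInvSeq ω).count t : ℕ) := by
  rw [invParity, ← wordProd_reverse, lift_signedConj_wordProd, rightInvSeq_reverse, count_reverse,
    zero_add]

/-- This cocycle identity is the functoriality of the signed action; it allows parities to be
computed without choosing words. -/
theorem invParity_mul (u v t : W) :
    cs.invParity (u * v) t = cs.invParity u t + cs.invParity v (u⁻¹ * t * u) := by
  classical
  obtain ⟨ω, hω⟩ := cs.wordProd_surjective u⁻¹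
  obtain ⟨ω', hω'⟩ := cs.wordProd_surjective v⁻¹
  rw [invParity, invParity, invParity, mul_inv_rev, map_mul, Equiv.Perm.mul_apply, ← hω, ← hω',
    lift_signedConj_wordProd, lift_signedConj_wordProd, lift_signedConj_wordProd, hω]
  simp

theorem invParity_one (t : W) : cs.invParity 1 t = 0 := by
  simp [invParity]

open scoped Classical in
theorem invParity_simple (i : B) (t : W) :
    cs.invParity (cs.simple i) t = if t = cs.simple i then 1 else 0 := by
  have := cs.invParity_wordProd [i] t
  rw [wordProd_singleton, leftInvSeq_singleton, count_singleton] at this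
  rw [this]
  by_cases h : t = cs.simple i
  · simp [h]
  · simp [h, Ne.symm h]

/-- For $t=wsw^{-1}$ the contributions of $w$ and $w^{-1}$ cancel, by the cocycle identity for
$ww^{-1}=1$; the middle factor $s$ contributes $1$. -/
theorem IsReflection.invParity_self {t : W} (ht : cs.IsReflection t) : cs.invParity t t = 1 := by
  obtain ⟨w, i, rfl⟩ := ht
  have h := cs.invParity_mul w w⁻¹ (w * cs.simple i * w⁻¹)
  rw [mul_inv_cancel, invParity_one] at h
  have e1 : w⁻¹ * (w * cs.simple i * w⁻¹) * w = cs.simple i := by group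
  rw [e1] at h
  rw [mul_assoc, invParity_mul, ← mul_assoc, e1, invParity_mul, invParity_simple, if_pos rfl]
  rw [show (cs.simple i)⁻¹ * cs.simple i * cs.simple i = cs.simple i by group,
    add_left_comm, ← h, add_zero]

theorem mem_leftInvSeq_of_invParity {ω : List B} {t : W}
    (h : cs.invParity (cs.wordProd ω) t = 1) : t ∈ cs.leftInvSeq ω := by
  classical
  by_contra hn
  rw [invParity_wordProd, count_eq_zero_of_not_mem hn] at h
  simp at h

/-- Odd parity puts $t$ in the inversion sequence of a reduced word. If the parity at $w$ is even,
it is odd at $tw$, so $t$ is an inversion of $tw$ and hence not of $w$. -/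
theorem isLeftInversion_iff_invParity {w t : W} (ht : cs.IsReflection t) :
    cs.IsLeftInversion w t ↔ cs.invParity w t = 1 := by
  have key : ∀ w, cs.invParity w t = 1 → cs.IsLeftInversion w t := by
    intro w h
    obtain ⟨ω, hω, rfl⟩ := cs.exists_isReduced w
    exact cs.isLeftInversion_of_mem_leftInvSeq hω (cs.mem_leftInvSeq_of_invParity h)
  refine ⟨fun h => ?_, key w⟩
  by_contra hn
  have h2 : ∀ x : ZMod 2, x ≠ 1 → x = 0 := by decide
  have h0 := h2 _ hn
  have := cs.invParity_mul t w t
  rw [ht.invParity_self, ht.inv, ht.mul_self, one_mul, h0, add_zero] at this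
  have h3 := (key _ this).2
  rw [← mul_assoc, ht.mul_self, one_mul] at h3
  exact absurd h3 (not_lt_of_gt h.2)

/-- The strong exchange condition. -/
theorem IsLeftInversion.mem_leftInvSeq {ω : List B} {t : W}
    (h : cs.IsLeftInversion (cs.wordProd ω) t) : t ∈ cs.leftInvSeq ω :=
  cs.mem_leftInvSeq_of_invParity ((cs.isLeftInversion_iff_invParity h.1).mp h)

theorem exists_wordProd_eraseIdx_of_isLeftDescent {ω : List B} {i : B}
    (h : cs.IsLeftDescent (cs.wordProd ω) i) :
    ∃ j < ω.length, cs.simple i * cs.wordProd ω = cs.wordProd (ω.eraseIdx j) := by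
  obtain ⟨j, hj, hj'⟩ := List.mem_iff_getElem.mp
    (IsLeftInversion.mem_leftInvSeq cs ((cs.isLeftInversion_simple_iff_isLeftDescent _ i).mpr h))
  have hj2 : j < ω.length := by simpa using hj
  refine ⟨j, hj2, ?_⟩
  rw [← getD_leftInvSeq_mul_wordProd, getD_eq_getElem _ _ hj, hj']

/-- Entries without repetition have odd parity, so all of them occur in the inversion sequence of
any reduced word for the same element. Counting shows that word is at least as long. -/
theorem isReduced_of_nodup_leftInvSeq {ω : List B} (h : (cs.leftInvSeq ω).Nodup) :
    cs.IsReduced ω := by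
  classical
  obtain ⟨ω', hω', he⟩ := cs.exists_isReduced (cs.wordProd ω)
  have hsub : cs.leftInvSeq ω ⊆ cs.leftInvSeq ω' := by
    intro t ht
    apply cs.mem_leftInvSeq_of_invParity
    rw [← he, invParity_wordProd, count_eq_one_of_mem h ht]
    simp
  have hle := (h.subperm hsub).length_le
  rw [length_leftInvSeq, length_leftInvSeq] at hle
  refine le_antisymm (cs.length_wordProd_le ω) ?_
  rwa [he, hω'.eq]

/-- Right multiplication by $s$ changes the set of left inversions only at $wsw^{-1}$, which `hne`
excludes. -/
theorem length_mul_simple_lt_iff {w t : W} {i : B} (ht : cs.IsReflection t)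
    (hne : t * w ≠ w * cs.simple i) :
    cs.length (t * (w * cs.simple i)) < cs.length (w * cs.simple i) ↔
      cs.length (t * w) < cs.length w := by
  have h1 := cs.isLeftInversion_iff_invParity (w := w * cs.simple i) ht
  have h2 := cs.isLeftInversion_iff_invParity (w := w) ht
  rw [IsLeftInversion] at h1 h2
  simp only [ht, true_and] at h1 h2
  rw [h1, h2, invParity_mul, invParity_simple, if_neg, add_zero]
  rw [mul_assoc, inv_mul_eq_iff_eq_mul]
  exact hne

theorem length_simple_mul_lt_of_ne {u t : W} {i : B} (ht : cs.IsReflection t)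
    (hne : t ≠ cs.simple i) (h : cs.length u < cs.length (t * u)) :
    cs.length (cs.simple i * u) < cs.length (cs.simple i * (t * u)) := by
  have ht' : cs.IsReflection (cs.simple i * t * cs.simple i) := by
    simpa using ht.conj (cs.simple i)
  have h1 : cs.invParity (t * u) t = 1 := by
    rw [← cs.isLeftInversion_iff_invParity ht]
    refine ⟨ht, ?_⟩
    rwa [← mul_assoc, ht.mul_self, one_mul]
  have h2 : cs.IsLeftInversion (cs.simple i * (t * u)) (cs.simple i * t * cs.simple i) := by
    rw [cs.isLeftInversion_iff_invParity ht', invParity_mul, invParity_simple, if_neg, zero_add]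
    · simpa [mul_assoc] using h1
    · rwa [mul_eq_right, mul_eq_one_iff_eq_inv', inv_simple]
  have h3 := h2.2
  rwa [show cs.simple i * t * cs.simple i * (cs.simple i * (t * u)) = cs.simple i * u by
    rw [mul_assoc (cs.simple i * t), simple_mul_simple_cancel_left, mul_assoc, ← mul_assoc t t,
      ht.mul_self, one_mul]] at h3

end CoxeterSystem

namespace CoxeterSystem

open List

variable {B W : Type*} [Group W] {M : CoxeterMatrix B} (cs : CoxeterSystem M W)

/-! ### Alternating words and Matsumoto's theorem -/

/-- Two equal entries would make a power of $s_js_i$ with exponent strictly between $0$ and `M i j`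
trivial, against the exact order. -/
theorem nodup_take_leftInvSeq_alternatingWord {i j : B} (hij : i ≠ j) {m : ℕ} (hm : m ≤ M i j) :
    (cs.leftInvSeq ((alternatingWord i j (2 * M i j)).take m)).Nodup := by
  rw [leftInvSeq_take, nodup_iff_pairwise_ne, pairwise_iff_getElem]
  intro k l hk hl hkl
  simp only [length_take, length_leftInvSeq, length_alternatingWord] at hk hl
  rw [getElem_take, getElem_take, getElem_leftInvSeq_alternatingWord _ _ _ _ _ (by omega),
    getElem_leftInvSeq_alternatingWord _ _ _ _ _ (by omega),
    prod_alternatingWord_eq_mul_pow, prod_alternatingWord_eq_mul_pow]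
  rw [show (2 * k + 1) / 2 = k by omega, show (2 * l + 1) / 2 = k + (l - k) by omega, pow_add, if_neg (by simp),
    if_neg (by simp), ← mul_assoc]
  intro h
  refine cs.simple_mul_simple_pow_ne_one hij.symm (Nat.sub_pos_of_lt hkl) ?_
    (mul_eq_left.mp h.symm)
  intro _
  rw [M.symmetric j i]
  omega

theorem isReduced_alternatingWord {i j : B} (hij : i ≠ j) {m : ℕ} (hm : m ≤ M i j) :
    cs.IsReduced (alternatingWord i j m) := by
  rcases Nat.eq_zero_or_pos m with rfl | h0
  · simp [IsReduced, alternatingWord]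
  apply isReduced_of_nodup_leftInvSeq
  by_cases h : Even m
  · have := cs.nodup_take_leftInvSeq_alternatingWord hij hm
    rwa [listTake_alternatingWord _ _ _ _ (by omega), if_pos h] at this
  · rw [M.symmetric i j] at hm
    have := cs.nodup_take_leftInvSeq_alternatingWord hij.symm hm
    rwa [listTake_alternatingWord _ _ _ _ (by omega), if_neg h] at this

theorem simple_mul_simple_pow_eq_one_of_wordProd_eq {i j : B} {m : ℕ}
    (h : cs.wordProd (alternatingWord i j m) = cs.wordProd (alternatingWord j i m)) :
    (cs.simple i * cs.simple j) ^ m = 1 := by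
  rw [prod_alternatingWord_eq_mul_pow, prod_alternatingWord_eq_mul_pow,
    show cs.simple j * cs.simple i = (cs.simple i * cs.simple j)⁻¹ by simp, inv_pow] at h
  obtain ⟨k, rfl | rfl⟩ := Nat.even_or_odd' m
  · rw [if_pos (even_two_mul k), if_pos (even_two_mul k), one_mul, one_mul,
      Nat.mul_div_cancel_left _ two_pos, eq_inv_iff_mul_eq_one, ← pow_add] at h
    rwa [two_mul]
  · have h2 : (2 * k + 1) / 2 = k := by omega
    rw [if_neg (by simp), if_neg (by simp), h2] at h
    rw [← mul_left_cancel_iff (a := cs.simple i), simple_mul_simple_cancel_left, ← mul_assoc,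
      eq_inv_iff_mul_eq_one, mul_assoc, ← pow_add, ← pow_succ'] at h
    rwa [two_mul]

theorem isReduced_of_cons {i : B} {ω : List B} (h : cs.IsReduced (i :: ω)) : cs.IsReduced ω := by
  simpa using h.drop 1

section Matsumoto

variable {A : Type*} [Monoid A] (f : B → A)

theorem prod_map_cons_eq {n : ℕ}
    (ih : ∀ ω ω' : List B, cs.IsReduced ω → cs.IsReduced ω' → ω.length = n →
      cs.wordProd ω = cs.wordProd ω' → (ω.map f).prod = (ω'.map f).prod)
    {i : B} {ω ω' : List B} (hω : cs.IsReduced (i :: ω)) (hω' : cs.IsReduced (i :: ω'))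
    (hn : ω.length = n) (h : cs.wordProd (i :: ω) = cs.wordProd (i :: ω')) :
    ((i :: ω).map f).prod = ((i :: ω').map f).prod := by
  rw [wordProd_cons, wordProd_cons, mul_right_inj] at h
  rw [map_cons, map_cons, prod_cons, prod_cons,
    ih ω ω' (cs.isReduced_of_cons hω) (cs.isReduced_of_cons hω') hn h]

theorem prod_map_append_eq {n : ℕ}
    (ih : ∀ ω ω' : List B, cs.IsReduced ω → cs.IsReduced ω' → ω.length = n →
      cs.wordProd ω = cs.wordProd ω' → (ω.map f).prod = (ω'.map f).prod)
    {i : B} {ω ω' : List B} (hω : cs.IsReduced (ω ++ [i])) (hω' : cs.IsReduced (ω' ++ [i]))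
    (hn : ω.length = n) (h : cs.wordProd (ω ++ [i]) = cs.wordProd (ω' ++ [i])) :
    ((ω ++ [i]).map f).prod = ((ω' ++ [i]).map f).prod := by
  rw [wordProd_append, wordProd_append, mul_left_inj] at h
  have h1 : cs.IsReduced ω := by simpa using hω.take ω.length
  have h2 : cs.IsReduced ω' := by simpa using hω'.take ω'.length
  rw [map_append, map_append, prod_append, prod_append, ih ω ω' h1 h2 hn h]

/-- If two reduced words `ω` and `i :: τ` of the same element have different products under `f`,
then so do the reduced words `i :: ω.dropLast` and `ω`. -/
theorem exchange_step {n : ℕ}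
    (ih : ∀ ω ω' : List B, cs.IsReduced ω → cs.IsReduced ω' → ω.length = n →
      cs.wordProd ω = cs.wordProd ω' → (ω.map f).prod = (ω'.map f).prod)
    {i : B} {ω τ : List B} (hω : cs.IsReduced ω) (hτ : cs.IsReduced (i :: τ))
    (hn : ω.length = n + 1) (h : cs.wordProd ω = cs.wordProd (i :: τ))
    (hne : (ω.map f).prod ≠ ((i :: τ).map f).prod) :
    cs.IsReduced (i :: ω.take n) ∧ cs.wordProd (i :: ω.take n) = cs.wordProd ω ∧
      ((i :: ω.take n).map f).prod ≠ (ω.map f).prod := by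
  have hd : cs.IsLeftDescent (cs.wordProd ω) i := by
    have h1 : cs.length (cs.wordProd (i :: τ)) = τ.length + 1 := hτ
    rw [IsLeftDescent, h, wordProd_cons, simple_mul_simple_cancel_left, ← wordProd_cons, h1]
    exact Nat.lt_succ_of_le (cs.length_wordProd_le τ)
  obtain ⟨j, hj, he⟩ := cs.exists_wordProd_eraseIdx_of_isLeftDescent hd
  have hw : cs.wordProd (i :: ω.eraseIdx j) = cs.wordProd ω := by
    rw [wordProd_cons, ← he, simple_mul_simple_cancel_left]
  have hlen : (ω.eraseIdx j).length = n := by rw [length_eraseIdx_of_lt hj, hn]; rfl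
  have hr : cs.IsReduced (i :: ω.eraseIdx j) := by
    rw [IsReduced, hw, hω.eq, length_cons, hlen, hn]
  have hp : ((i :: ω.eraseIdx j).map f).prod = ((i :: τ).map f).prod :=
    cs.prod_map_cons_eq f ih hr hτ hlen (hw.trans h)
  obtain rfl | hjn : j = n ∨ j < n := by omega
  · have : ω.eraseIdx j = ω.take j := by
      rw [eraseIdx_eq_take_drop_succ, drop_eq_nil_of_le (by omega), append_nil]
    rw [this] at hw hr hp
    exact ⟨hr, hw, by rw [hp]; exact hne.symm⟩
  -- If the erased letter is not the last one, the new word and `ω` share their last letter, so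
  -- induction identifies their products, contrary to `hne`.
  · exfalso
    obtain ⟨ρ, b, rfl⟩ : ∃ ρ b, ω = ρ ++ [b] :=
      ⟨_, _, (dropLast_append_getLast (ne_nil_of_length_pos (by omega))).symm⟩
    simp only [length_append, length_singleton, Nat.add_right_cancel_iff] at hn
    have e : i :: (ρ ++ [b]).eraseIdx j = (i :: ρ.eraseIdx j) ++ [b] := by
      rw [eraseIdx_append_of_lt_length (by omega)]; rfl
    rw [e] at hw hr hp
    exact hne ((cs.prod_map_append_eq f ih hω hr hn hw.symm).trans hp)

/-- Matsumoto's theorem: a product over a reduced word of elements that satisfy the braid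
relations depends only on the group element that the word represents. -/
theorem prod_map_eq_of_isReduced
    (hf : ∀ i j, ((braidWord M i j).map f).prod = ((braidWord M j i).map f).prod)
    {ω ω' : List B} (hω : cs.IsReduced ω) (hω' : cs.IsReduced ω')
    (h : cs.wordProd ω = cs.wordProd ω') : (ω.map f).prod = (ω'.map f).prod := by
  obtain ⟨n, hn⟩ : ∃ n, ω.length = n := ⟨_, rfl⟩
  induction n generalizing ω ω' with
  | zero =>
    have h' : ω'.length = 0 := by rw [← hω'.eq, ← h, hω.eq, hn]
    rw [List.length_eq_zero_iff.mp hn, List.length_eq_zero_iff.mp h']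
  | succ n ih =>
    have ih' : ∀ ω ω' : List B, cs.IsReduced ω → cs.IsReduced ω' → ω.length = n →
      cs.wordProd ω = cs.wordProd ω' → (ω.map f).prod = (ω'.map f).prod :=
      fun _ _ h1 h2 h3 h4 => ih h1 h2 h4 h3
    have hn' : ω'.length = n + 1 := by rw [← hω'.eq, ← h, hω.eq, hn]
    by_contra hne
    obtain ⟨i, ρ, rfl⟩ := exists_cons_of_length_eq_add_one hn
    obtain ⟨j, ρ', rfl⟩ := exists_cons_of_length_eq_add_one hn'
    have hij : i ≠ j := by
      rintro rfl
      exact hne (cs.prod_map_cons_eq f ih' hω hω' (by simpa using hn) h)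
    -- Each exchange drops the last letter and puts $j$ or $i$ in front, alternately. Repeating it
    -- $n+1$ times leaves a purely alternating word.
    set τ : ℕ → List B := fun k => alternatingWord i j k ++ (i :: ρ).take (n + 1 - k) with hτ
    have hlen : ∀ k ≤ n + 1, (τ k).length = n + 1 := by
      intro k hk
      rw [hτ, length_append, length_alternatingWord, length_take, hn]
      omega
    have hsucc : ∀ k ≤ n, τ (k + 1) = (if Even k then j else i) :: (τ k).take n := by
      intro k hk
      simp only [hτ, alternatingWord_succ', cons_append, take_append, length_alternatingWord,
        take_take, cons.injEq, true_and]
      rw [take_of_length_le (l := alternatingWord i j k) (by simpa using hk),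
        min_eq_left (by omega), Nat.add_sub_add_right]
    have hhead : ∀ k ≤ n, ∃ σ, τ k = (if Even k then i else j) :: σ := by
      intro k hk
      cases k with
      | zero => exact ⟨ρ, by simp [hτ, alternatingWord, ← hn]⟩
      | succ k =>
        refine ⟨(τ k).take n, (hsucc k (by omega)).trans ?_⟩
        by_cases hk : Even k <;> simp [hk, Nat.even_add_one]
    have h0 : τ 0 = i :: ρ := by simp [hτ, alternatingWord, ← hn]
    have key : ∀ k ≤ n, cs.IsReduced (τ k) ∧ cs.IsReduced (τ (k + 1)) ∧
        cs.wordProd (τ (k + 1)) = cs.wordProd (τ k) ∧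
        ((τ (k + 1)).map f).prod ≠ ((τ k).map f).prod := by
      intro k hk
      induction k with
      | zero =>
        rw [hsucc 0 hk, h0, if_pos Even.zero]
        exact ⟨hω, cs.exchange_step f ih' hω hω' hn h hne⟩
      | succ k ihk =>
        obtain ⟨h1, h2, h3, h4⟩ := ihk (by omega)
        refine ⟨h2, ?_⟩
        obtain ⟨σ, hσ⟩ := hhead k (by omega)
        rw [hσ] at h1 h3 h4
        have := cs.exchange_step f ih' h2 h1 (hlen _ (by omega)) h3 h4
        rw [hsucc (k + 1) hk]
        rwa [show (if Even (k + 1) then j else i) = if Even k then i else j by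
          by_cases hk : Even k <;> simp [hk, Nat.even_add_one]]
    -- The last two words are the two alternating words of length $n+1$. They represent the same
    -- element and are reduced, which forces $n+1=m(s_i,s_j)$, so the braid relation contradicts
    -- `h4`.
    obtain ⟨h1, h2, h3, h4⟩ := key n le_rfl
    have e1 : τ n = alternatingWord j i (n + 1) := by
      simp [hτ, alternatingWord_succ]
    have e2 : τ (n + 1) = alternatingWord i j (n + 1) := by simp [hτ]
    rw [e1] at h1 h3 h4
    rw [e2] at h2 h3 h4
    have hpow := cs.simple_mul_simple_pow_eq_one_of_wordProd_eq h3
    have hM : M i j ≠ 0 ∧ M i j ≤ n + 1 := by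
      by_contra hc
      exact cs.simple_mul_simple_pow_ne_one hij n.succ_pos (fun _ => by omega) hpow
    have hM' : n + 1 = M i j := by
      refine le_antisymm ?_ hM.2
      by_contra hc
      exact cs.not_isReduced_alternatingWord i j hM.1 (by omega) h2
    have := hf i j
    rw [braidWord, braidWord, M.symmetric j i, ← hM'] at this
    exact h4 this

end Matsumoto

end CoxeterSystem

/-! ### Commuting left and right Hecke operators on the free module on $W$. -/

namespace CoxeterSystem

variable {B W : Type*} [Group W] {M : CoxeterMatrix B} (cs : CoxeterSystem M W)

theorem isLeftDescent_mul_simple_iff {w : W} {i j : B}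
    (h : cs.simple i * w ≠ w * cs.simple j) :
    cs.IsLeftDescent (w * cs.simple j) i ↔ cs.IsLeftDescent w i :=
  cs.length_mul_simple_lt_iff (cs.isReflection_simple i) h

theorem isRightDescent_simple_mul_iff {w : W} {i j : B}
    (h : cs.simple i * w ≠ w * cs.simple j) :
    cs.IsRightDescent (cs.simple i * w) j ↔ cs.IsRightDescent w j := by
  rw [← isLeftDescent_inv_iff, ← isLeftDescent_inv_iff, mul_inv_rev, inv_simple]
  apply isLeftDescent_mul_simple_iff
  intro h'
  apply h
  have := congrArg (·⁻¹) h'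
  simpa using this.symm

variable {R : Type*} [CommRing R] (a b : R)

open Finsupp

open scoped Classical in
/-- The operator on the free module on `W` by which `T_s` acts from the left. -/
def heckeLeft (i : B) : Module.End R (W →₀ R) :=
  linearCombination R fun w => if cs.IsLeftDescent w i then
    a • single w 1 + b • single (cs.simple i * w) 1 else single (cs.simple i * w) 1

open scoped Classical in
/-- The operator on the free module on `W` by which `T_s` acts from the right. -/
def heckeRight (i : B) : Module.End R (W →₀ R) :=
  linearCombination R fun w => if cs.IsRightDescent w i then
    a • single w 1 + b • single (w * cs.simple i) 1 else single (w * cs.simple i) 1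

open scoped Classical in
theorem heckeLeft_single (i : B) (w : W) :
    cs.heckeLeft a b i (single w 1) = if cs.IsLeftDescent w i then
      a • single w 1 + b • single (cs.simple i * w) 1 else single (cs.simple i * w) 1 := by
  simp [heckeLeft]

open scoped Classical in
theorem heckeRight_single (i : B) (w : W) :
    cs.heckeRight a b i (single w 1) = if cs.IsRightDescent w i then
      a • single w 1 + b • single (w * cs.simple i) 1 else single (w * cs.simple i) 1 := by
  simp [heckeRight]

theorem _root_.Finsupp.end_ext {ι R : Type*} [CommRing R] {X Y : Module.End R (ι →₀ R)} (h : ∀ w, X (single w 1) = Y (single w 1)) :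
    X = Y := by
  ext w : 2
  simpa using h w

/-- If $sw\ne ws'$, the left descent at $s$ and the right descent at $s'$ do not influence each
other. If $sw=ws'$, the two descent conditions coincide and both operators agree on the vectors
involved. -/
theorem commute_heckeLeft_heckeRight (i j : B) :
    Commute (cs.heckeLeft a b i) (cs.heckeRight a b j) := by
  apply end_ext
  intro w
  rw [Module.End.mul_apply, Module.End.mul_apply]
  by_cases h : cs.simple i * w = w * cs.simple j
  · have h1 : cs.IsLeftDescent w i ↔ cs.IsRightDescent w j := by
      rw [IsLeftDescent, IsRightDescent, h]
    have h2 : cs.IsLeftDescent (w * cs.simple j) i ↔ ¬ cs.IsRightDescent w j := by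
      rw [← h, ← h1]
      exact not_iff_not.mp (by rw [not_not, ← isLeftDescent_iff_not_isLeftDescent_mul])
    have h3 : cs.IsRightDescent (w * cs.simple j) j ↔ ¬ cs.IsRightDescent w j :=
      not_iff_not.mp (by rw [not_not, ← isRightDescent_iff_not_isRightDescent_mul])
    have h4 : cs.simple i * (w * cs.simple j) = w := by
      rw [← h, simple_mul_simple_cancel_left]
    rw [heckeLeft_single, heckeRight_single]
    by_cases hd : cs.IsRightDescent w j <;>
      simp [-smul_single, h1, hd, h, h2, h3, h4, heckeLeft_single, heckeRight_single]
  · have h1 := cs.isLeftDescent_mul_simple_iff h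
    have h2 := cs.isRightDescent_simple_mul_iff h
    rw [heckeLeft_single, heckeRight_single]
    by_cases hd : cs.IsRightDescent w j <;> by_cases hd' : cs.IsLeftDescent w i <;>
      simp [-smul_single, h1, h2, hd, hd', heckeLeft_single, heckeRight_single,
        mul_assoc]
    module

theorem heckeLeft_mul_self (i : B) :
    cs.heckeLeft a b i * cs.heckeLeft a b i = a • cs.heckeLeft a b i + algebraMap R _ b := by
  apply end_ext
  intro w
  have h1 : cs.IsLeftDescent (cs.simple i * w) i ↔ ¬ cs.IsLeftDescent w i :=
    not_iff_not.mp (by rw [not_not, ← isLeftDescent_iff_not_isLeftDescent_mul])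
  rw [Module.End.mul_apply, LinearMap.add_apply, LinearMap.smul_apply,
    Module.algebraMap_end_apply, heckeLeft_single]
  by_cases hd : cs.IsLeftDescent w i <;>
    simp [-smul_single, h1, hd, heckeLeft_single]

/-- The right operators produce every basis vector from the one at $1$, going up in length. -/
theorem eq_of_commute_heckeRight {X Y : Module.End R (W →₀ R)}
    (hX : ∀ i, Commute X (cs.heckeRight a b i)) (hY : ∀ i, Commute Y (cs.heckeRight a b i))
    (h : X (single 1 1) = Y (single 1 1)) : X = Y := by
  apply end_ext
  intro w
  obtain ⟨n, hn⟩ : ∃ n, cs.length w = n := ⟨_, rfl⟩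
  induction n generalizing w with
  | zero => rwa [cs.length_eq_zero_iff.mp hn]
  | succ n ih =>
    have hw : w ≠ 1 := by rintro rfl; simp at hn
    obtain ⟨i, hi⟩ := cs.exists_rightDescent_of_ne_one hw
    have hl : cs.length (w * cs.simple i) = n := by
      have := cs.isRightDescent_iff.mp hi
      omega
    have e : single w (1 : R) = cs.heckeRight a b i (single (w * cs.simple i) 1) := by
      rw [heckeRight_single, if_neg, simple_mul_simple_cancel_right]
      exact cs.isRightDescent_iff_not_isRightDescent_mul.mp hi
    rw [e, ← Module.End.mul_apply, ← Module.End.mul_apply, (hX i).eq, (hY i).eq,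
      Module.End.mul_apply, Module.End.mul_apply, ih _ hl]

theorem not_isLeftDescent_of_isReduced_cons {i : B} {ω : List B} (h : cs.IsReduced (i :: ω)) :
    ¬ cs.IsLeftDescent (cs.wordProd ω) i := by
  rw [not_isLeftDescent_iff, ← wordProd_cons, h.eq, (cs.isReduced_of_cons h).eq, List.length_cons]

theorem prod_map_heckeLeft_single {ω : List B} (hω : cs.IsReduced ω) :
    (ω.map (cs.heckeLeft a b)).prod (single 1 1) = single (cs.wordProd ω) 1 := by
  induction ω with
  | nil => simp
  | cons i ω ih =>
    rw [List.map_cons, List.prod_cons, Module.End.mul_apply, ih (cs.isReduced_of_cons hω),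
      heckeLeft_single, if_neg (cs.not_isLeftDescent_of_isReduced_cons hω), wordProd_cons]

/-- Both products commute with the right operators, so it is enough to compare them at the vector
$1$; no computation in the dihedral subgroup is needed. -/
theorem heckeLeft_braid (i j : B) :
    ((braidWord M i j).map (cs.heckeLeft a b)).prod =
      ((braidWord M j i).map (cs.heckeLeft a b)).prod := by
  rcases eq_or_ne i j with rfl | hij
  · rfl
  have hc : ∀ ω : List B, ∀ k, Commute (ω.map (cs.heckeLeft a b)).prod (cs.heckeRight a b k) := by
    intro ω k
    apply Commute.list_prod_left
    intro x hx
    obtain ⟨j, -, rfl⟩ := List.mem_map.mp hx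
    exact cs.commute_heckeLeft_heckeRight a b j k
  apply cs.eq_of_commute_heckeRight a b (hc _) (hc _)
  rw [prod_map_heckeLeft_single _ _ _ (cs.isReduced_alternatingWord hij le_rfl),
    prod_map_heckeLeft_single _ _ _ (cs.isReduced_alternatingWord hij.symm le_rfl),
    wordProd_braidWord_eq]

end CoxeterSystem

/-! ### The standard basis of the Hecke algebra. -/

namespace HeckeAlgebra

open CoxeterSystem Finsupp

variable {B W R : Type*} [Group W] [CommRing R] {M : CoxeterMatrix B} (cs : CoxeterSystem M W)

section

variable (a b : R)

/-- The left regular representation of the Hecke algebra, on the free module on `W`. -/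
def regularRep : HeckeAlgebra M a b →ₐ[R] Module.End R (W →₀ R) :=
  RingQuot.liftAlgHom R ⟨FreeAlgebra.lift R (cs.heckeLeft a b), by
    intro x y h
    cases h with
    | quadratic s =>
      rw [map_mul, map_add, map_smul, AlgHom.commutes, FreeAlgebra.lift_ι_apply,
        heckeLeft_mul_self]
    | braid s s' =>
      rw [map_list_prod, map_list_prod, List.map_map, List.map_map]
      simp only [Function.comp_def, FreeAlgebra.lift_ι_apply]
      exact cs.heckeLeft_braid a b s s'⟩

theorem regularRep_gen (i : B) : regularRep cs a b (gen M a b i) = cs.heckeLeft a b i := by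
  refine (RingQuot.liftAlgHom_mkAlgHom_apply R _ _ (FreeAlgebra.ι R i)).trans ?_
  rw [FreeAlgebra.lift_ι_apply]

theorem stdT_wordProd {ω : List B} (hω : cs.IsReduced ω) :
    stdT a b cs (cs.wordProd ω) = (ω.map (gen M a b)).prod := by
  have h := (cs.exists_isReduced (cs.wordProd ω)).choose_spec
  exact cs.prod_map_eq_of_isReduced _ (gen_braid M a b) h.1 hω h.2.symm

theorem stdT_one : stdT a b cs 1 = 1 := by
  have := stdT_wordProd cs a b (ω := []) (by simp [CoxeterSystem.IsReduced])
  simpa using this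

theorem gen_mul_stdT_of_not_isLeftDescent {w : W} {i : B} (h : ¬ cs.IsLeftDescent w i) :
    gen M a b i * stdT a b cs w = stdT a b cs (cs.simple i * w) := by
  obtain ⟨ω, hω, rfl⟩ := cs.exists_isReduced w
  have hr : cs.IsReduced (i :: ω) := by
    rw [CoxeterSystem.IsReduced, wordProd_cons, cs.not_isLeftDescent_iff.mp h, hω.eq, List.length_cons]
  rw [stdT_wordProd cs a b hω, ← wordProd_cons, stdT_wordProd cs a b hr, List.map_cons,
    List.prod_cons]

theorem gen_mul_stdT_of_isLeftDescent {w : W} {i : B} (h : cs.IsLeftDescent w i) :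
    gen M a b i * stdT a b cs w = a • stdT a b cs w + b • stdT a b cs (cs.simple i * w) := by
  have h1 := gen_mul_stdT_of_not_isLeftDescent cs a b
    (cs.isLeftDescent_iff_not_isLeftDescent_mul.mp h)
  rw [simple_mul_simple_cancel_left] at h1
  rw [← h1, ← mul_assoc, gen_mul_gen, add_mul, smul_mul_assoc, h1, ← Algebra.smul_def]

theorem regularRep_stdT (w : W) : regularRep cs a b (stdT a b cs w) (single 1 1) = single w 1 := by
  obtain ⟨ω, hω, rfl⟩ := cs.exists_isReduced w
  rw [stdT_wordProd cs a b hω, map_list_prod, List.map_map,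
    ← prod_map_heckeLeft_single cs a b hω]
  congr 3
  ext1 i
  exact regularRep_gen cs a b i

/-- Acting on the basis vector at $1$ sends $T_w$ to the basis vector at $w$. -/
theorem linearIndependent_stdT : LinearIndependent R (stdT a b cs) := by
  let φ : HeckeAlgebra M a b →ₗ[R] W →₀ R :=
    (LinearMap.applyₗ (single 1 1)).comp (regularRep cs a b).toLinearMap
  apply LinearIndependent.of_comp φ
  convert (Finsupp.basisSingleOne (R := R) (ι := W)).linearIndependent using 1
  ext1 w
  rw [Finsupp.coe_basisSingleOne]
  exact regularRep_stdT cs a b w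

theorem induction_gen_mul {p : HeckeAlgebra M a b → Prop} (one : p 1)
    (gen_mul : ∀ i x, p x → p (gen M a b i * x)) (add : ∀ x y, p x → p y → p (x + y))
    (smul : ∀ (r : R) x, p x → p (r • x)) (x : HeckeAlgebra M a b) : p x := by
  let π : FreeAlgebra R B →ₐ[R] HeckeAlgebra M a b := RingQuot.mkAlgHom R (HeckeRel M a b)
  obtain ⟨y, rfl⟩ : ∃ y, π y = x := RingQuot.mkAlgHom_surjective R (HeckeRel M a b) x
  suffices h : ∀ z, p z → p (π y * z) by
    have := h 1 one
    rwa [mul_one] at this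
  induction y using FreeAlgebra.induction with
  | grade0 r =>
    intro z hz
    rw [AlgHom.commutes]
    have := smul r z hz
    rwa [Algebra.smul_def] at this
  | grade1 i => exact gen_mul i
  | mul x y hx hy =>
    intro z hz
    rw [map_mul, mul_assoc]
    exact hx _ (hy _ hz)
  | add x y hx hy =>
    intro z hz
    rw [map_add, add_mul]
    exact add _ _ (hx _ hz) (hy _ hz)

theorem span_range_stdT : ⊤ ≤ Submodule.span R (Set.range (stdT a b cs)) := by
  rintro x -
  induction x using induction_gen_mul with
  | one => exact Submodule.subset_span ⟨1, stdT_one cs a b⟩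
  | add x y hx hy => exact add_mem hx hy
  | smul r x hx => exact Submodule.smul_mem _ r hx
  | gen_mul i x hx =>
    induction hx using Submodule.span_induction with
    | mem x h =>
      obtain ⟨w, rfl⟩ := h
      by_cases hd : cs.IsLeftDescent w i
      · rw [gen_mul_stdT_of_isLeftDescent cs a b hd]
        exact add_mem (Submodule.smul_mem _ _ (Submodule.subset_span ⟨_, rfl⟩))
          (Submodule.smul_mem _ _ (Submodule.subset_span ⟨_, rfl⟩))
      · rw [gen_mul_stdT_of_not_isLeftDescent cs a b hd]
        exact Submodule.subset_span ⟨_, rfl⟩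
    | zero => rw [mul_zero]; exact zero_mem _
    | add x y _ _ hx hy => rw [mul_add]; exact add_mem hx hy
    | smul r x _ hx => rw [mul_smul_comm]; exact Submodule.smul_mem _ r hx

/-- The basis `(T_w)` of the Hecke algebra. -/
def stdBasis : Module.Basis W R (HeckeAlgebra M a b) :=
  Module.Basis.mk (linearIndependent_stdT cs a b) (span_range_stdT cs a b)

@[simp]
theorem stdBasis_apply (w : W) : stdBasis cs a b w = stdT a b cs w :=
  Module.Basis.mk_apply _ _ w

end

end HeckeAlgebra

namespace CoxeterSystem

variable {B W : Type*} [Group W] {M : CoxeterMatrix B} (cs : CoxeterSystem M W)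

/-! ### The Bruhat order -/

theorem BruhatLE.refl (w : W) : cs.BruhatLE w w :=
  Relation.TransGen.single ⟨le_rfl, 1, Or.inr rfl, (one_mul w).symm⟩

variable {cs} in
theorem BruhatLE.trans {u v w : W} (h : cs.BruhatLE u v) (h' : cs.BruhatLE v w) :
    cs.BruhatLE u w :=
  Relation.TransGen.trans h h'

variable {cs} in
theorem BruhatLE.eq_or_length_lt {u w : W} (h : cs.BruhatLE u w) :
    u = w ∨ cs.length u < cs.length w := by
  have step : ∀ u w : W, (cs.length u ≤ cs.length w ∧ ∃ t, (cs.IsReflection t ∨ t = 1) ∧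
      w = t * u) → u = w ∨ cs.length u < cs.length w := by
    rintro u w ⟨hl, t, ht | rfl, rfl⟩
    · exact Or.inr (lt_of_le_of_ne hl (ht.length_mul_right_ne u).symm)
    · exact Or.inl (one_mul u).symm
  induction h with
  | single h => exact step _ _ h
  | tail _ h ih =>
    obtain rfl | h1 := ih
    · exact step _ _ h
    · obtain rfl | h2 := step _ _ h
      · exact Or.inr h1
      · exact Or.inr (h1.trans h2)

variable {cs} in
theorem BruhatLT.length_lt {u w : W} (h : cs.BruhatLT u w) : cs.length u < cs.length w :=
  h.1.eq_or_length_lt.resolve_left h.2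

variable {cs} in
theorem BruhatLE.trans_lt {u v w : W} (h : cs.BruhatLE u v) (h' : cs.BruhatLT v w) :
    cs.BruhatLT u w := by
  refine ⟨h.trans h'.1, ?_⟩
  rintro rfl
  have h1 := h'.length_lt
  obtain rfl | h2 := h.eq_or_length_lt <;> omega

-- This is a form of the lifting property. In one generating step $u\to tu$, either $t=s$ and $su$
-- is the upper element, or $su\to stu$ is again a step, by `length_simple_mul_lt_of_ne`.
variable {cs} in
theorem BruhatLE.simple_mul {u w : W} (h : cs.BruhatLE u w) (i : B) :
    cs.BruhatLE (cs.simple i * u) w ∨ cs.BruhatLE (cs.simple i * u) (cs.simple i * w) := by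
  have step : ∀ u w : W, (cs.length u ≤ cs.length w ∧ ∃ t, (cs.IsReflection t ∨ t = 1) ∧
      w = t * u) → cs.simple i * u = w ∨ cs.BruhatLE (cs.simple i * u) (cs.simple i * w) := by
    rintro u w ⟨hl, t, ht | rfl, rfl⟩
    · by_cases hti : t = cs.simple i
      · exact Or.inl (by rw [hti])
      · have hlt := lt_of_le_of_ne hl (ht.length_mul_right_ne u).symm
        refine Or.inr (Relation.TransGen.single
          ⟨(cs.length_simple_mul_lt_of_ne ht hti hlt).le, cs.simple i * t * cs.simple i,
            Or.inl ?_, ?_⟩)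
        · simpa using ht.conj (cs.simple i)
        · simp [mul_assoc]
    · rw [one_mul]
      exact Or.inr (BruhatLE.refl cs _)
  induction h using Relation.TransGen.head_induction_on with
  | single h =>
    obtain h1 | h1 := step _ _ h
    · rw [h1]
      exact Or.inl (BruhatLE.refl cs _)
    · exact Or.inr h1
  | head h h' ih =>
    obtain h1 | h1 := step _ _ h
    · rw [h1]
      exact Or.inl h'
    · exact ih.imp h1.trans h1.trans

theorem bruhatLE_simple_mul {w : W} {i : B} (h : ¬ cs.IsLeftDescent w i) :
    cs.BruhatLE w (cs.simple i * w) := by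
  refine Relation.TransGen.single ⟨?_, cs.simple i, Or.inl (cs.isReflection_simple i), rfl⟩
  rw [cs.not_isLeftDescent_iff.mp h]
  omega

theorem exists_simple_mul_of_ne_one {w : W} (hw : w ≠ 1) :
    ∃ i u, w = cs.simple i * u ∧ ¬ cs.IsLeftDescent u i ∧ cs.length w = cs.length u + 1 := by
  obtain ⟨i, hi⟩ := cs.exists_leftDescent_of_ne_one hw
  refine ⟨i, cs.simple i * w, by simp, cs.isLeftDescent_iff_not_isLeftDescent_mul.mp hi, ?_⟩
  rw [cs.isLeftDescent_iff.mp hi]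

/-! ### Coordinates in the normalized Hecke algebra -/

open LaurentPolynomial (T)

/-- The basis `(T_w)` of the normalized Hecke algebra. -/
abbrev nBasis : Module.Basis W ℤ[T;T⁻¹] (NHecke M) := HeckeAlgebra.stdBasis cs _ _

theorem nBasis_apply (w : W) : cs.nBasis w = cs.nT w := HeckeAlgebra.stdBasis_apply cs _ _ w

theorem nBasis_repr_nT (w : W) : cs.nBasis.repr (cs.nT w) = Finsupp.single w 1 := by
  rw [← nBasis_apply, Module.Basis.repr_self]

open scoped Classical in
theorem nBasis_repr_gen_mul (i : B) (x : NHecke M) (y : W) :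
    cs.nBasis.repr (HeckeAlgebra.gen M _ _ i * x) y = cs.nBasis.repr x (cs.simple i * y) +
      (if cs.IsLeftDescent y i then T 1 - T (-1) else 0) * cs.nBasis.repr x y := by
  suffices h : (cs.nBasis.coord y).comp (LinearMap.mulLeft _ (HeckeAlgebra.gen M _ _ i)) =
      cs.nBasis.coord (cs.simple i * y) +
        (if cs.IsLeftDescent y i then T 1 - T (-1) else 0 : ℤ[T;T⁻¹]) • cs.nBasis.coord y from
    LinearMap.congr_fun h x
  apply cs.nBasis.ext
  intro z
  have hz : cs.simple i * z = y ↔ z = cs.simple i * y :=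
    ⟨fun h => by rw [← h, simple_mul_simple_cancel_left],
      fun h => by rw [h, simple_mul_simple_cancel_left]⟩
  rw [nBasis_apply, LinearMap.comp_apply, LinearMap.mulLeft_apply]
  by_cases hd : cs.IsLeftDescent z i
  · rw [HeckeAlgebra.gen_mul_stdT_of_isLeftDescent cs _ _ hd]
    by_cases hy : z = y
    · subst hy
      simp [nBasis_repr_nT, Finsupp.single_apply, hd, hz, add_comm]
    · by_cases hdy : cs.IsLeftDescent y i <;>
        simp [nBasis_repr_nT, Finsupp.single_apply, hz, hy, hdy]
  · rw [HeckeAlgebra.gen_mul_stdT_of_not_isLeftDescent cs _ _ hd]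
    by_cases hy : z = y
    · subst hy
      simp [nBasis_repr_nT, Finsupp.single_apply, hd, hz]
    · by_cases hdy : cs.IsLeftDescent y i <;>
        simp [nBasis_repr_nT, Finsupp.single_apply, hz, hy, hdy]

/-- The coefficient of `q ^ j T_y` in an element of the normalized Hecke algebra. -/
def nCoeff (y : W) (j : ℤ) : NHecke M →+ ℤ where
  toFun x := (cs.nBasis.repr x y).coeff j
  map_zero' := by simp
  map_add' x x' := by simp

theorem nCoeff_apply (y : W) (j : ℤ) (x : NHecke M) :
    cs.nCoeff y j x = (cs.nBasis.repr x y).coeff j := rfl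

theorem ext_nCoeff {x x' : NHecke M} (h : ∀ y j, cs.nCoeff y j x = cs.nCoeff y j x') : x = x' := by
  apply cs.nBasis.repr.injective
  ext y j
  exact h y j

theorem _root_.LaurentPolynomial.coeff_T_mul (n j : ℤ) (f : ℤ[T;T⁻¹]) :
    (T n * f).coeff j = f.coeff (j - n) := by
  rw [T, AddMonoidAlgebra.coeff_single_mul_apply, one_mul, neg_add_eq_sub]

open scoped Classical in
theorem nCoeff_nT (y w : W) (j : ℤ) :
    cs.nCoeff y j (cs.nT w) = if w = y ∧ j = 0 then 1 else 0 := by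
  rw [nCoeff_apply, nBasis_repr_nT, Finsupp.single_apply]
  by_cases h : w = y
  · rw [if_pos h, ← LaurentPolynomial.T_zero, LaurentPolynomial.T_apply]
    simp [h, eq_comm]
  · simp [h]

-- The element $T_s-q$ is fixed by bar and drives the induction. Where $sy<y$, the diagonal term
-- $q-q^{-1}$ of $T_s$ turns the factor $-q$ into $-q^{-1}$.
open scoped Classical in
theorem nCoeff_gen_sub_mul (i : B) (x : NHecke M) (y : W) (j : ℤ) :
    cs.nCoeff y j ((HeckeAlgebra.gen M _ _ i - algebraMap ℤ[T;T⁻¹] _ (T 1)) * x) =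
      cs.nCoeff (cs.simple i * y) j x -
        cs.nCoeff y (if cs.IsLeftDescent y i then j + 1 else j - 1) x := by
  have h : cs.nBasis.repr ((HeckeAlgebra.gen M _ _ i - algebraMap ℤ[T;T⁻¹] _ (T 1)) * x) y =
      cs.nBasis.repr x (cs.simple i * y) -
        T (if cs.IsLeftDescent y i then -1 else 1) * cs.nBasis.repr x y := by
    rw [sub_mul, ← Algebra.smul_def, map_sub, Finsupp.sub_apply, nBasis_repr_gen_mul, map_smul,
      Finsupp.smul_apply, smul_eq_mul]
    split_ifs <;> ring
  rw [nCoeff_apply, h, AddMonoidAlgebra.coeff_sub, Finsupp.sub_apply,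
    LaurentPolynomial.coeff_T_mul, nCoeff_apply, nCoeff_apply]
  split_ifs <;> simp

/-! ### The bar involution is unitriangular -/

theorem nBar_gen (i : B) : nBar M (HeckeAlgebra.gen M _ _ i) =
    HeckeAlgebra.gen M _ _ i - algebraMap ℤ[T;T⁻¹] _ (T 1 - T (-1)) := by
  refine (HeckeAlgebra.bar_gen M _ _ _ _ _ i).trans ?_
  change laurentBar 1 • (_ : NHecke M) = _
  rw [map_one, one_smul]

theorem nBar_smul (r : ℤ[T;T⁻¹]) (x : NHecke M) : nBar M (r • x) = laurentBar r • nBar M x :=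
  HeckeAlgebra.bar_smul M _ _ _ _ _ r x

/-- The span of the `T_y` with `ℓ(y) < n`. -/
def lengthLT (n : ℕ) : Submodule ℤ[T;T⁻¹] (NHecke M) :=
  Submodule.span _ (cs.nT '' {y | cs.length y < n})

theorem nT_mem_lengthLT {w : W} {n : ℕ} (h : cs.length w < n) : cs.nT w ∈ cs.lengthLT n :=
  Submodule.subset_span ⟨w, h, rfl⟩

theorem lengthLT_mono {m n : ℕ} (h : m ≤ n) : cs.lengthLT m ≤ cs.lengthLT n :=
  Submodule.span_mono (Set.image_mono fun _ hy => lt_of_lt_of_le hy h)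

theorem repr_eq_zero_of_mem_lengthLT {n : ℕ} {x : NHecke M} (hx : x ∈ cs.lengthLT n) {y : W}
    (hy : n ≤ cs.length y) : cs.nBasis.repr x y = 0 := by
  have h : cs.nT '' {y | cs.length y < n} = cs.nBasis '' {y | cs.length y < n} :=
    Set.image_congr fun w _ => (cs.nBasis_apply w).symm
  rw [lengthLT, h, Module.Basis.mem_span_image] at hx
  by_contra hc
  have := hx (Finsupp.mem_support_iff.mpr hc)
  simp only [Set.mem_ofPred_eq] at this
  omega

theorem gen_mul_mem_lengthLT (i : B) {n : ℕ} {x : NHecke M} (hx : x ∈ cs.lengthLT n) :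
    HeckeAlgebra.gen M _ _ i * x ∈ cs.lengthLT (n + 1) := by
  induction hx using Submodule.span_induction with
  | mem x h =>
    obtain ⟨w, hw, rfl⟩ := h
    simp only [Set.mem_ofPred_eq] at hw
    have hl := cs.length_simple_mul w i
    have h1 : cs.nT (cs.simple i * w) ∈ cs.lengthLT (n + 1) := cs.nT_mem_lengthLT (by omega)
    by_cases hd : cs.IsLeftDescent w i
    · rw [HeckeAlgebra.gen_mul_stdT_of_isLeftDescent cs _ _ hd]
      exact add_mem (Submodule.smul_mem _ _ (cs.nT_mem_lengthLT (by omega)))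
        (Submodule.smul_mem _ _ h1)
    · rwa [HeckeAlgebra.gen_mul_stdT_of_not_isLeftDescent cs _ _ hd]
  | zero => rw [mul_zero]; exact zero_mem _
  | add x y _ _ hx hy => rw [mul_add]; exact add_mem hx hy
  | smul r x _ hx => rw [mul_smul_comm]; exact Submodule.smul_mem _ r hx

theorem nBar_nT_sub_mem (w : W) : nBar M (cs.nT w) - cs.nT w ∈ cs.lengthLT (cs.length w) := by
  obtain ⟨n, hn⟩ : ∃ n, cs.length w = n := ⟨_, rfl⟩
  induction n generalizing w with
  | zero =>
    rw [cs.length_eq_zero_iff.mp hn, nT, HeckeAlgebra.stdT_one, map_one, sub_self]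
    exact zero_mem _
  | succ n ih =>
    obtain ⟨i, u, rfl, hd, hl⟩ :=
      cs.exists_simple_mul_of_ne_one (w := w) (by rintro rfl; simp at hn)
    have hu : cs.length u = n := by omega
    have h := ih u hu
    set d := nBar M (cs.nT u) - cs.nT u with hdef
    have hb : nBar M (cs.nT u) = cs.nT u + d := by rw [hdef]; abel
    have e : nBar M (cs.nT (cs.simple i * u)) - cs.nT (cs.simple i * u) =
        HeckeAlgebra.gen M _ _ i * d - (T 1 - T (-1) : ℤ[T;T⁻¹]) • (cs.nT u + d) := by
      rw [nT, ← HeckeAlgebra.gen_mul_stdT_of_not_isLeftDescent cs _ _ hd, map_mul, nBar_gen, hb,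
        sub_mul, ← Algebra.smul_def, mul_add]
      abel
    rw [e, hl]
    refine sub_mem (cs.gen_mul_mem_lengthLT i h) (Submodule.smul_mem _ _ (add_mem ?_ ?_))
    · exact cs.nT_mem_lengthLT (by omega)
    · exact cs.lengthLT_mono (by omega) h

/-- At $y$ of maximal length in the support, unitriangularity makes the coefficient of $T_y$
invariant under $q\mapsto q^{-1}$. Having only positive powers, it vanishes. -/
theorem eq_zero_of_nBar_eq {x : NHecke M} (hb : nBar M x = x)
    (h : ∀ y, ∀ j ≤ 0, cs.nCoeff y j x = 0) : x = 0 := by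
  by_contra hx
  obtain ⟨y, hy, hmax⟩ := Finset.exists_max_image (cs.nBasis.repr x).support cs.length
    (Finsupp.support_nonempty_iff.mpr (by simpa using hx))
  have hsum : cs.nBasis.repr (nBar M x) y = laurentBar (cs.nBasis.repr x y) := by
    conv_lhs => rw [← cs.nBasis.linearCombination_repr x, Finsupp.linearCombination_apply,
      Finsupp.sum, map_sum, map_sum, Finsupp.finsetSum_apply]
    have hT : ∀ v ∈ (cs.nBasis.repr x).support,
        cs.nBasis.repr (nBar M (cs.nT v)) y = Finsupp.single v 1 y := by
      intro v hv
      have h1 := cs.repr_eq_zero_of_mem_lengthLT (cs.nBar_nT_sub_mem v)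
        (Nat.le_refl _ |>.trans (hmax v hv))
      rwa [map_sub, Finsupp.sub_apply, sub_eq_zero, nBasis_repr_nT] at h1
    rw [Finset.sum_eq_single y]
    · rw [nBar_smul, map_smul, Finsupp.smul_apply, nBasis_apply, hT y hy, Finsupp.single_eq_same,
        smul_eq_mul, mul_one]
    · intro v hv hvy
      rw [nBar_smul, map_smul, Finsupp.smul_apply, nBasis_apply, hT v hv,
        Finsupp.single_eq_of_ne hvy.symm, smul_zero]
    · exact fun hc => absurd hy hc
  rw [hb] at hsum
  apply Finsupp.mem_support_iff.mp hy
  ext j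
  obtain hj | hj := le_or_gt j 0
  · exact h y j hj
  · have := congrArg (fun f => f.coeff j) hsum
    simp only [laurentBar] at this
    rw [this]
    exact (LaurentPolynomial.invert_apply _ j).trans (h y (-j) (by omega))

open scoped Classical in
/-- `x` is fixed by the bar involution and lies in `T_w + q ∑_y ℤ[q] T_y`. -/
structure IsCanonical (w : W) (x : NHecke M) : Prop where
  bar_eq : nBar M x = x
  nCoeff_eq : ∀ y, ∀ j ≤ 0, cs.nCoeff y j x = if y = w ∧ j = 0 then 1 else 0

variable {cs} in
theorem IsCanonical.unique {w : W} {x x' : NHecke M} (h : cs.IsCanonical w x)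
    (h' : cs.IsCanonical w x') : x = x' := by
  rw [← sub_eq_zero]
  apply cs.eq_zero_of_nBar_eq
  · rw [map_sub, h.bar_eq, h'.bar_eq]
  · intro y j hj
    rw [map_sub, h.nCoeff_eq y j hj, h'.nCoeff_eq y j hj, sub_self]

/-- The properties by which the canonical basis element `c_w` is constructed inductively. -/
structure IsCanonicalStrong (w : W) (x : NHecke M) : Prop where
  bar_eq : nBar M x = x
  nCoeff_self : cs.nCoeff w 0 x = 1
  bruhatLE : ∀ y j, cs.nCoeff y j x ≠ 0 → cs.BruhatLE y w
  nonneg : ∀ y j, cs.nCoeff y j x ≠ 0 → 0 ≤ j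
  eq_of_zero : ∀ y, cs.nCoeff y 0 x ≠ 0 → y = w
  le : ∀ y j, cs.nCoeff y j x ≠ 0 → j ≤ cs.length w - cs.length y
  even : ∀ y j, cs.nCoeff y j x ≠ 0 → Even (cs.length w - cs.length y - j : ℤ)

variable {cs} in
theorem IsCanonicalStrong.isCanonical {w : W} {x : NHecke M} (h : cs.IsCanonicalStrong w x) :
    cs.IsCanonical w x where
  bar_eq := h.bar_eq
  nCoeff_eq y j hj := by
    split_ifs with hc
    · rw [hc.1, hc.2, h.nCoeff_self]
    · by_contra hne
      obtain rfl : j = 0 := le_antisymm hj (h.nonneg y j hne)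
      exact hc ⟨h.eq_of_zero y hne, rfl⟩

theorem isCanonicalStrong_one : cs.IsCanonicalStrong 1 (1 : NHecke M) := by
  classical
  have key : ∀ y j, cs.nCoeff y j (1 : NHecke M) = if 1 = y ∧ j = 0 then 1 else 0 := by
    intro y j
    rw [← cs.nCoeff_nT, nT, HeckeAlgebra.stdT_one]
  constructor
  · exact map_one _
  · simp [key]
  all_goals
    intro y
    simp only [key]
    grind [BruhatLE.refl]

theorem nBar_gen_sub (i : B) : nBar M (HeckeAlgebra.gen M _ _ i - algebraMap ℤ[T;T⁻¹] _ (T 1)) =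
    HeckeAlgebra.gen M _ _ i - algebraMap ℤ[T;T⁻¹] _ (T 1) := by
  have h : nBar M (algebraMap ℤ[T;T⁻¹] _ (T 1)) = algebraMap ℤ[T;T⁻¹] _ (T (-1)) := by
    rw [Algebra.algebraMap_eq_smul_one, nBar_smul, map_one, laurentBar_T,
      ← Algebra.algebraMap_eq_smul_one]
  rw [map_sub, nBar_gen, h, map_sub]
  abel

end CoxeterSystem

namespace CoxeterSystem

variable {B W : Type*} [Group W] {M : CoxeterMatrix B} (cs : CoxeterSystem M W)

open LaurentPolynomial (T)

/-! ### Existence of the canonical basis -/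

section Step

variable {cs} {i : B} {u : W} {x : NHecke M}

theorem IsCanonicalStrong.bruhatLE_gen_sub_mul (hx : cs.IsCanonicalStrong u x)
    (hd : ¬ cs.IsLeftDescent u i) {y : W} {j : ℤ}
    (h : cs.nCoeff y j ((HeckeAlgebra.gen M _ _ i - algebraMap ℤ[T;T⁻¹] _ (T 1)) * x) ≠ 0) :
    cs.BruhatLE y (cs.simple i * u) := by
  rw [nCoeff_gen_sub_mul] at h
  by_cases h1 : cs.nCoeff (cs.simple i * y) j x = 0
  · rw [h1, zero_sub, neg_ne_zero] at h
    exact (hx.bruhatLE _ _ h).trans (cs.bruhatLE_simple_mul hd)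
  · have := (hx.bruhatLE _ _ h1).simple_mul i
    rw [simple_mul_simple_cancel_left] at this
    exact this.elim (fun h => h.trans (cs.bruhatLE_simple_mul hd)) id

theorem IsCanonicalStrong.bounds_gen_sub_mul (hx : cs.IsCanonicalStrong u x)
    (hd : ¬ cs.IsLeftDescent u i) {y : W} {j : ℤ}
    (h : cs.nCoeff y j ((HeckeAlgebra.gen M _ _ i - algebraMap ℤ[T;T⁻¹] _ (T 1)) * x) ≠ 0) :
    0 ≤ j ∧ j ≤ cs.length (cs.simple i * u) - cs.length y ∧
      Even (cs.length (cs.simple i * u) - cs.length y - j : ℤ) := by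
  rw [nCoeff_gen_sub_mul] at h
  rw [cs.not_isLeftDescent_iff.mp hd]
  push_cast
  by_cases h1 : cs.nCoeff (cs.simple i * y) j x = 0
  · rw [h1, zero_sub, neg_ne_zero] at h
    split_ifs at h with hy
    · have h2 := hx.nonneg _ _ h
      have h3 := hx.le _ _ h
      have h4 := hx.even _ _ h
      -- The factor $q^{-1}$ could only create a negative exponent from a constant term of $c_u$.
      -- The only one is at $u$, which does not have $s$ as a left descent.
      have h5 : j + 1 ≠ 0 := by
        intro h0
        rw [h0] at h
        rw [hx.eq_of_zero _ h] at hy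
        exact hd hy
      refine ⟨by omega, by omega, ?_⟩
      rw [Int.even_iff] at h4 ⊢
      omega
    · have h2 := hx.nonneg _ _ h
      have h3 := hx.le _ _ h
      have h4 := hx.even _ _ h
      refine ⟨by omega, by omega, ?_⟩
      rw [Int.even_iff] at h4 ⊢
      omega
  · have h2 := hx.nonneg _ _ h1
    have h3 := hx.le _ _ h1
    have h4 := hx.even _ _ h1
    have hl := cs.length_simple_mul y i
    refine ⟨by omega, by omega, ?_⟩
    rw [Int.even_iff] at h4 ⊢
    omega

theorem IsCanonicalStrong.nCoeff_gen_sub_mul_self (hx : cs.IsCanonicalStrong u x)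
    (hd : ¬ cs.IsLeftDescent u i) : cs.nCoeff (cs.simple i * u) 0
      ((HeckeAlgebra.gen M _ _ i - algebraMap ℤ[T;T⁻¹] _ (T 1)) * x) = 1 := by
  rw [nCoeff_gen_sub_mul, simple_mul_simple_cancel_left, hx.nCoeff_self]
  have h : ∀ j, cs.nCoeff (cs.simple i * u) j x = 0 := by
    intro j
    by_contra hne
    have h1 := hx.nonneg _ _ hne
    have h2 := hx.le _ _ hne
    rw [cs.not_isLeftDescent_iff.mp hd] at h2
    push_cast at h2
    omega
  rw [h, sub_zero]

end Step

theorem exists_isCanonicalStrong (w : W) : ∃ x : NHecke M, cs.IsCanonicalStrong w x := by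
  classical
  obtain ⟨n, hn⟩ : ∃ n, cs.length w = n := ⟨_, rfl⟩
  induction n using Nat.strong_induction_on generalizing w with
  | _ n ih =>
  by_cases hw : w = 1
  · subst hw
    exact ⟨1, cs.isCanonicalStrong_one⟩
  obtain ⟨i, u, rfl, hd, hl⟩ := cs.exists_simple_mul_of_ne_one hw
  obtain ⟨x, hx⟩ := ih (cs.length u) (by omega) u rfl
  -- `c y` is arbitrary for $y$ of length at least $n$; only shorter elements, those in `S`, are
  -- used.
  choose! c hc using fun y (hy : cs.length y < n) => ih (cs.length y) hy y rfl
  set w := cs.simple i * u with hwdef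
  set z := (HeckeAlgebra.gen M _ _ i - algebraMap ℤ[T;T⁻¹] _ (T 1)) * x with hz
  have hzb : nBar M z = z := by rw [hz, map_mul, nBar_gen_sub, hx.bar_eq]
  have hzle : ∀ y j, cs.nCoeff y j z ≠ 0 → cs.BruhatLE y w :=
    fun y j => hx.bruhatLE_gen_sub_mul hd
  have hzbd : ∀ y j, cs.nCoeff y j z ≠ 0 → 0 ≤ j ∧ j ≤ cs.length w - cs.length y ∧
      Even (cs.length w - cs.length y - j : ℤ) := fun y j => hx.bounds_gen_sub_mul hd
  have hzw : cs.nCoeff w 0 z = 1 := hx.nCoeff_gen_sub_mul_self hd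
  clear_value z
  set S := (cs.nBasis.repr z).support.erase w with hS
  have hmem : ∀ y, y ≠ w → ∀ j, cs.nCoeff y j z ≠ 0 → y ∈ S := by
    intro y hy j h
    refine Finset.mem_erase.mpr ⟨hy, Finsupp.mem_support_iff.mpr fun h0 => h ?_⟩
    rw [nCoeff_apply, h0]
    rfl
  have hlt : ∀ y ∈ S, cs.length y < n := by
    intro y hy
    obtain ⟨hyw, hy⟩ := Finset.mem_erase.mp hy
    obtain ⟨j, hj⟩ : ∃ j, cs.nCoeff y j z ≠ 0 := by
      by_contra! h
      exact Finsupp.mem_support_iff.mp hy (LaurentPolynomial.ext h)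
    have := (hzle y j hj).eq_or_length_lt.resolve_left hyw
    omega
  have hcoeff : ∀ y j, cs.nCoeff y j (z - ∑ v ∈ S, cs.nCoeff v 0 z • c v) =
      cs.nCoeff y j z - ∑ v ∈ S, cs.nCoeff v 0 z * cs.nCoeff y j (c v) := by
    intro y j
    rw [map_sub, map_sum]
    simp only [map_zsmul, smul_eq_mul]
  have hterm : ∀ y j, cs.nCoeff y j (z - ∑ v ∈ S, cs.nCoeff v 0 z • c v) ≠ 0 →
      cs.nCoeff y j z ≠ 0 ∨ ∃ v ∈ S, cs.nCoeff v 0 z ≠ 0 ∧ cs.nCoeff y j (c v) ≠ 0 := by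
    intro y j h
    rw [hcoeff] at h
    by_contra! hcon
    apply h
    rw [hcon.1, zero_sub, neg_eq_zero]
    refine Finset.sum_eq_zero fun v hv => ?_
    by_cases h0 : cs.nCoeff v 0 z = 0
    · rw [h0, zero_mul]
    · rw [hcon.2 v hv h0, mul_zero]
  refine ⟨z - ∑ v ∈ S, cs.nCoeff v 0 z • c v, ?_, ?_, ?_, ?_, ?_, ?_, ?_⟩
  · rw [map_sub, hzb, map_sum]
    congr 1
    refine Finset.sum_congr rfl fun v hv => ?_
    rw [map_zsmul, (hc v (hlt v hv)).bar_eq]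
  · rw [hcoeff, hzw, Finset.sum_eq_zero, sub_zero]
    intro v hv
    rw [mul_eq_zero]
    right
    by_contra hne
    exact (Finset.mem_erase.mp hv).1 ((hc v (hlt v hv)).eq_of_zero _ hne).symm
  · intro y j h
    obtain h | ⟨v, hv, h1, h2⟩ := hterm y j h
    · exact hzle y j h
    · exact ((hc v (hlt v hv)).bruhatLE y j h2).trans (hzle v 0 h1)
  · intro y j h
    obtain h | ⟨v, hv, h1, h2⟩ := hterm y j h
    · exact (hzbd y j h).1
    · exact (hc v (hlt v hv)).nonneg y j h2
  -- Among the $c_v$ only $c_y$ has a constant term at $T_y$, namely $1$, so the subtraction removes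
  -- precisely the constant term of `z` there. The multipliers are integers, hence bar-invariant.
  · intro y
    contrapose!
    intro hyw
    rw [hcoeff, sub_eq_zero]
    have hself : ∀ v ∈ S, cs.nCoeff v 0 z * cs.nCoeff y 0 (c v) =
        if v = y then cs.nCoeff y 0 z else 0 := by
      intro v hv
      rw [(hc v (hlt v hv)).isCanonical.nCoeff_eq y 0 le_rfl]
      by_cases hvy : v = y
      · simp [hvy]
      · simp [hvy, Ne.symm hvy]
    rw [Finset.sum_congr rfl hself, Finset.sum_ite_eq']
    split_ifs with hy
    · rfl
    · by_contra hne
      exact hy (hmem y hyw 0 hne)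
  -- A term $c_v$ contributes only if $q^0T_v$ occurs in `z`, and then $l(w)-l(v)$ is nonnegative
  -- and even. So the degree bound, and below the parity, pass from $v$ to $w$.
  · intro y j h
    obtain h | ⟨v, hv, h1, h2⟩ := hterm y j h
    · exact (hzbd y j h).2.1
    · have h3 := (hc v (hlt v hv)).le y j h2
      have h4 := (hzbd v 0 h1).2.1
      omega
  · intro y j h
    obtain h | ⟨v, hv, h1, h2⟩ := hterm y j h
    · exact (hzbd y j h).2.2
    · have h3 := (hc v (hlt v hv)).even y j h2
      have h4 := (hzbd v 0 h1).2.2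
      rw [Int.even_iff] at h3 h4 ⊢
      omega

/-- The element `c_w` of the canonical basis. -/
def canon (w : W) : NHecke M := (cs.exists_isCanonicalStrong w).choose

theorem isCanonicalStrong_canon (w : W) : cs.IsCanonicalStrong w (cs.canon w) :=
  (cs.exists_isCanonicalStrong w).choose_spec

theorem isCanonical_canon (w : W) : cs.IsCanonical w (cs.canon w) :=
  (cs.isCanonicalStrong_canon w).isCanonical

theorem nBasis_repr_canon_self (w : W) : cs.nBasis.repr (cs.canon w) w = 1 := by
  ext j
  have h := cs.isCanonicalStrong_canon w
  change _ = (T 0 : ℤ[T;T⁻¹]).coeff j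
  rw [LaurentPolynomial.T_apply, ← nCoeff_apply]
  split_ifs with hj
  · rw [← hj, h.nCoeff_self]
  · by_contra hne
    have h1 := h.nonneg w j hne
    have h2 := h.le w j hne
    omega

theorem bruhatLE_of_repr_canon_ne_zero {y w : W} (h : cs.nBasis.repr (cs.canon w) y ≠ 0) :
    cs.BruhatLE y w := by
  by_contra hn
  apply h
  ext j
  by_contra hne
  exact hn ((cs.isCanonicalStrong_canon w).bruhatLE y j hne)

/-! ### Polynomials -/

/-- The polynomial with coefficients `g 0, …, g n`. -/
def polyOfFn (n : ℕ) (g : ℕ → ℤ) : ℤ[X] := ∑ k ∈ Finset.range (n + 1), Polynomial.monomial k (g k)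

theorem coeff_polyOfFn {n : ℕ} {g : ℕ → ℤ} (hg : ∀ k, n < k → g k = 0) (k : ℕ) :
    (polyOfFn n g).coeff k = g k := by
  rw [polyOfFn, Polynomial.finsetSum_coeff]
  simp only [Polynomial.coeff_monomial, Finset.sum_ite_eq', Finset.mem_range]
  split_ifs with h
  · rfl
  · exact (hg k (by omega)).symm

theorem _root_.Polynomial.coeff_toLaurent_natCast (f : ℤ[X]) (k : ℕ) :
    (Polynomial.toLaurent f).coeff k = f.coeff k := by
  induction f using Polynomial.induction_on' with
  | add p q hp hq =>
    rw [map_add, AddMonoidAlgebra.coeff_add, Finsupp.add_apply, hp, hq, Polynomial.coeff_add]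
  | monomial n a =>
    rw [← Polynomial.C_mul_X_pow_eq_monomial, Polynomial.toLaurent_C_mul_X_pow, mul_comm,
      LaurentPolynomial.coeff_T_mul, LaurentPolynomial.C_apply, Polynomial.coeff_C_mul_X_pow]
    simp [sub_eq_zero]

theorem _root_.Polynomial.coeff_toLaurent_of_neg (f : ℤ[X]) {j : ℤ} (hj : j < 0) :
    (Polynomial.toLaurent f).coeff j = 0 := by
  induction f using Polynomial.induction_on' with
  | add p q hp hq =>
    rw [map_add, AddMonoidAlgebra.coeff_add, Finsupp.add_apply, hp, hq, add_zero]
  | monomial n a =>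
    rw [← Polynomial.C_mul_X_pow_eq_monomial, Polynomial.toLaurent_C_mul_X_pow, mul_comm,
      LaurentPolynomial.coeff_T_mul, LaurentPolynomial.C_apply, if_neg (by omega)]

open scoped Classical in
theorem _root_.LaurentPolynomial.coeff_aeval_T_neg_two (f : ℤ[X]) (j : ℤ) :
    (Polynomial.aeval (T (-2) : ℤ[T;T⁻¹]) f).coeff j =
      if j ≤ 0 ∧ Even j then f.coeff (j / 2).natAbs else 0 := by
  induction f using Polynomial.induction_on' with
  | add p q hp hq =>
    rw [map_add, AddMonoidAlgebra.coeff_add, Finsupp.add_apply, hp, hq]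
    split_ifs <;> simp
  | monomial n a =>
    rw [Polynomial.aeval_monomial, LaurentPolynomial.T_pow, mul_comm,
      LaurentPolynomial.coeff_T_mul, LaurentPolynomial.algebraMap_apply,
      LaurentPolynomial.C_apply, Polynomial.coeff_monomial]
    simp only [Int.even_iff]
    split_ifs <;> first | rfl | (exfalso; omega)

theorem _root_.LaurentPolynomial.aeval_T_neg_two_injective :
    Function.Injective (Polynomial.aeval (T (-2) : ℤ[T;T⁻¹]) : ℤ[X] → ℤ[T;T⁻¹]) := by
  classical
  intro f g h
  ext k
  have := congrArg (fun f => f.coeff (-2 * (k : ℤ))) h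
  simp only [LaurentPolynomial.coeff_aeval_T_neg_two] at this
  rw [if_pos ⟨by omega, by simp⟩, if_pos ⟨by omega, by simp⟩] at this
  rwa [show (-2 * (k : ℤ) / 2).natAbs = k by omega] at this

end CoxeterSystem

/-! ### The canonical basis with its polynomials, and its uniqueness. -/

namespace CoxeterSystem

variable {B W : Type*} [Group W] {M : CoxeterMatrix B} (cs : CoxeterSystem M W)

open LaurentPolynomial (T)

theorem _root_.Module.Basis.repr_finsuppSum_smul {ι R N A : Type*} [CommRing R] [AddCommGroup N]
    [Module R N] [Zero A] (b : Module.Basis ι R N) (P : ι →₀ A) (g : ι → A → R)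
    (hg : ∀ i, g i 0 = 0) (i : ι) : b.repr (P.sum fun j f => g j f • b j) i = g i (P i) := by
  rw [Finsupp.sum, map_sum, Finsupp.finsetSum_apply, Finset.sum_eq_single i]
  · simp
  · intro j _ hj
    simp [hj]
  · intro hi
    rw [Finsupp.notMem_support_iff.mp hi, hg]
    simp

theorem nBasis_repr_sum (P : W →₀ ℤ[X]) (g : W → ℤ[X] → ℤ[T;T⁻¹]) (hg : ∀ y, g y 0 = 0) (y : W) :
    cs.nBasis.repr (P.sum fun y f => g y f • cs.nT y) y = g y (P y) := by
  rw [← cs.nBasis.repr_finsuppSum_smul P g hg y]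
  simp only [nBasis_apply]

theorem nBasis_repr_c_eq {w : W} {x : NHecke M} {P : W →₀ ℤ[X]}
    (h : x = cs.nT w -
      (T 1 : ℤ[T;T⁻¹]) • P.sum fun y f => Polynomial.toLaurent f • cs.nT y) (y : W) :
    cs.nBasis.repr x y = Finsupp.single w 1 y - T 1 * Polynomial.toLaurent (P y) := by
  rw [h, map_sub, nBasis_repr_nT, map_smul, Finsupp.sub_apply, Finsupp.smul_apply, smul_eq_mul,
    cs.nBasis_repr_sum P (fun _ f => Polynomial.toLaurent f) (fun _ => map_zero _)]

/-- The polynomial `p_{y,w}`. -/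
def canonPoly (w y : W) : ℤ[X] :=
  polyOfFn (cs.length w - cs.length y) fun k => -cs.nCoeff y (k + 1) (cs.canon w)

theorem coeff_canonPoly (w y : W) (k : ℕ) :
    (cs.canonPoly w y).coeff k = -cs.nCoeff y (k + 1) (cs.canon w) := by
  apply coeff_polyOfFn
  intro k hk
  rw [neg_eq_zero]
  by_contra h
  have := (cs.isCanonicalStrong_canon w).le _ _ h
  omega

theorem canonPoly_eq_zero {w y : W} (h : ¬ cs.BruhatLT y w) : cs.canonPoly w y = 0 := by
  ext k
  rw [coeff_canonPoly, Polynomial.coeff_zero, neg_eq_zero]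
  by_contra hne
  refine h ⟨(cs.isCanonicalStrong_canon w).bruhatLE _ _ hne, ?_⟩
  rintro rfl
  have := (cs.isCanonicalStrong_canon y).le _ _ hne
  omega

theorem repr_canon_eq_canonPoly (w y : W) : cs.nBasis.repr (cs.canon w) y =
    Finsupp.single w 1 y - T 1 * Polynomial.toLaurent (cs.canonPoly w y) := by
  by_cases hy : y = w
  · subst hy
    rw [nBasis_repr_canon_self, canonPoly_eq_zero _ (fun h => h.2 rfl)]
    simp
  rw [Finsupp.single_eq_of_ne hy, zero_sub]
  ext j
  rw [AddMonoidAlgebra.coeff_neg, Finsupp.neg_apply, LaurentPolynomial.coeff_T_mul]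
  obtain hj | hj := le_or_gt j 0
  · rw [Polynomial.coeff_toLaurent_of_neg _ (by omega), neg_zero, ← nCoeff_apply,
      (cs.isCanonical_canon w).nCoeff_eq y j hj, if_neg (fun h => hy h.1)]
  · obtain ⟨k, rfl⟩ : ∃ k : ℕ, j = k + 1 := ⟨(j - 1).toNat, by omega⟩
    rw [add_sub_cancel_right, Polynomial.coeff_toLaurent_natCast, coeff_canonPoly, neg_neg,
      nCoeff_apply]

/-- The polynomials `p_{y,w}` as a finitely supported family in `y`. -/
def canonPolyFinsupp (w : W) : W →₀ ℤ[X] :=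
  Finsupp.onFinset (cs.nBasis.repr (cs.canon w)).support (cs.canonPoly w) <| by
    intro y hy
    rw [Finsupp.mem_support_iff]
    intro h
    apply hy
    ext k
    rw [coeff_canonPoly, nCoeff_apply, h]
    simp

theorem canonPolyFinsupp_apply (w y : W) : cs.canonPolyFinsupp w y = cs.canonPoly w y := rfl

theorem canon_eq (w : W) : cs.canon w = cs.nT w -
    (T 1 : ℤ[T;T⁻¹]) • (cs.canonPolyFinsupp w).sum
      fun y f => Polynomial.toLaurent f • cs.nT y := by
  apply cs.nBasis.repr.injective
  ext1 y
  rw [repr_canon_eq_canonPoly, cs.nBasis_repr_c_eq rfl, canonPolyFinsupp_apply]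

theorem nT_eq (w : W) : cs.nT w = cs.canon w +
    (T 1 : ℤ[T;T⁻¹]) • (cs.canonPolyFinsupp w).sum
      fun y f => Polynomial.toLaurent f • cs.nT y := by
  rw [← sub_eq_iff_eq_add, ← canon_eq]

theorem bruhatLT_of_mem_support {w y : W} (h : y ∈ (cs.canonPolyFinsupp w).support) :
    cs.BruhatLT y w := by
  by_contra hn
  exact Finsupp.mem_support_iff.mp h (cs.canonPoly_eq_zero hn)

theorem linearIndependent_canon : LinearIndependent ℤ[T;T⁻¹] cs.canon := by
  rw [linearIndependent_iff]
  intro l hl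
  by_contra hne
  obtain ⟨w, hw, hmax⟩ := Finset.exists_max_image l.support cs.length
    (Finsupp.support_nonempty_iff.mpr hne)
  apply Finsupp.mem_support_iff.mp hw
  have h := congrArg (fun x => cs.nBasis.repr x w) hl
  simp only [map_zero, Finsupp.zero_apply] at h
  rw [← h, Finsupp.linearCombination_apply, Finsupp.sum, map_sum, Finsupp.finsetSum_apply,
    Finset.sum_eq_single w]
  · rw [map_smul, Finsupp.smul_apply, nBasis_repr_canon_self, smul_eq_mul, mul_one]
  · intro v hv hvw
    rw [map_smul, Finsupp.smul_apply, smul_eq_mul]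
    by_contra h0
    obtain h1 | h1 :=
      (cs.bruhatLE_of_repr_canon_ne_zero (right_ne_zero_of_mul h0)).eq_or_length_lt
    · exact hvw h1.symm
    · exact absurd (hmax v hv) (not_le_of_gt h1)
  · exact fun hc => absurd hw hc

theorem span_range_canon : ⊤ ≤ Submodule.span ℤ[T;T⁻¹] (Set.range cs.canon) := by
  refine (HeckeAlgebra.span_range_stdT cs _ _).trans (Submodule.span_le.mpr ?_)
  rintro _ ⟨w, rfl⟩
  obtain ⟨n, hn⟩ : ∃ n, cs.length w = n := ⟨_, rfl⟩
  induction n using Nat.strong_induction_on generalizing w with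
  | _ n ih =>
  change cs.nT w ∈ _
  rw [nT_eq]
  refine add_mem (Submodule.subset_span ⟨w, rfl⟩)
    (Submodule.smul_mem _ _ (Submodule.sum_mem _ fun y hy => Submodule.smul_mem _ _ ?_))
  exact ih _ (hn ▸ (cs.bruhatLT_of_mem_support hy).length_lt) y rfl

/-- The canonical basis `(c_w)`. -/
def canonBasis : Module.Basis W ℤ[T;T⁻¹] (NHecke M) :=
  Module.Basis.mk cs.linearIndependent_canon cs.span_range_canon

theorem canonBasis_apply (w : W) : cs.canonBasis w = cs.canon w := Module.Basis.mk_apply _ _ w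

/-- The combination `∑_y P_y c_y` of the canonical basis elements. -/
def canonComb : (W →₀ ℤ[X]) →+ NHecke M :=
  Finsupp.liftAddHom fun y =>
    ((LinearMap.toSpanSingleton ℤ[T;T⁻¹] (NHecke M) (cs.canon y)).toAddMonoidHom).comp
      (Polynomial.toLaurent : ℤ[X] →+* ℤ[T;T⁻¹]).toAddMonoidHom

theorem canonComb_apply (P : W →₀ ℤ[X]) :
    cs.canonComb P = P.sum fun y f => Polynomial.toLaurent f • cs.canon y := rfl

theorem canonComb_smul (f : ℤ[X]) (P : W →₀ ℤ[X]) :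
    cs.canonComb (f • P) = Polynomial.toLaurent f • cs.canonComb P := by
  induction P using Finsupp.induction_linear with
  | zero => simp
  | add P Q hP hQ => rw [smul_add, map_add, hP, hQ, map_add, smul_add]
  | single y g =>
    rw [Finsupp.smul_single, canonComb_apply, canonComb_apply, Finsupp.sum_single_index,
      Finsupp.sum_single_index, smul_eq_mul, map_mul, mul_smul] <;> simp

/-- Inverting the unitriangular system by substituting the expansions of the shorter $T_v$ gives
$q_{y,w}=p_{y,w}+q\sum_v p_{v,w}q_{y,v}$. -/
theorem exists_nT_eq (w : W) : ∃ Q : W →₀ ℤ[X], (∀ y, ¬ cs.BruhatLT y w → Q y = 0) ∧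
    cs.nT w = cs.canon w + (T 1 : ℤ[T;T⁻¹]) • cs.canonComb Q := by
  obtain ⟨n, hn⟩ : ∃ n, cs.length w = n := ⟨_, rfl⟩
  induction n using Nat.strong_induction_on generalizing w with
  | _ n ih =>
  choose! Q hQ using fun y (hy : cs.length y < n) => ih (cs.length y) hy y rfl
  set p := cs.canonPolyFinsupp w with hp
  have hlt : ∀ y ∈ p.support, cs.BruhatLT y w := fun y hy => cs.bruhatLT_of_mem_support hy
  refine ⟨p + ∑ v ∈ p.support, (Polynomial.X * p v) • Q v, ?_, ?_⟩
  · intro y hy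
    rw [Finsupp.add_apply, Finsupp.finsetSum_apply, hp, canonPolyFinsupp_apply,
      cs.canonPoly_eq_zero hy, zero_add]
    refine Finset.sum_eq_zero fun v hv => ?_
    rw [Finsupp.smul_apply, (hQ v (hn ▸ (hlt v hv).length_lt)).1 y
      (fun h => hy (h.1.trans_lt (hlt v hv))), smul_zero]
  · rw [nT_eq]
    congr 2
    rw [map_add, map_sum, canonComb_apply, Finsupp.sum, Finsupp.sum, ← Finset.sum_add_distrib]
    refine Finset.sum_congr rfl fun v hv => ?_
    rw [(hQ v (hn ▸ (hlt v hv).length_lt)).2, canonComb_smul, smul_add, map_mul,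
      Polynomial.toLaurent_X, smul_smul, mul_comm (T 1)]

theorem exists_isCanonicalBasis : ∃ Q p, cs.IsCanonicalBasis cs.canonBasis Q p := by
  choose Q hQ using cs.exists_nT_eq
  refine ⟨Q, cs.canonPolyFinsupp, ?_, ?_, ?_, ?_, ?_⟩
  · intro w
    rw [canonBasis_apply, (cs.isCanonical_canon w).bar_eq]
  · exact fun y w h => (hQ w).1 y h
  · exact fun y w h => cs.canonPoly_eq_zero h
  · intro w
    simp only [canonBasis_apply]
    exact (hQ w).2
  · intro w
    rw [canonBasis_apply]
    exact cs.canon_eq w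

variable {cs} in
theorem IsCanonicalBasis.eq_canon {c : Module.Basis W ℤ[T;T⁻¹] (NHecke M)}
    {Q p : W → W →₀ ℤ[X]} (h : cs.IsCanonicalBasis c Q p) (w : W) : c w = cs.canon w := by
  classical
  refine IsCanonical.unique (cs := cs) (w := w) ⟨h.bar_eq w, ?_⟩ (cs.isCanonical_canon w)
  intro y j hj
  rw [nCoeff_apply, cs.nBasis_repr_c_eq (h.c_eq w), AddMonoidAlgebra.coeff_sub, Finsupp.sub_apply,
    LaurentPolynomial.coeff_T_mul, Polynomial.coeff_toLaurent_of_neg _ (by omega), sub_zero,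
    ← cs.nBasis_repr_nT, ← nCoeff_apply, nCoeff_nT]
  simp only [eq_comm]

theorem T_smul_injective : Function.Injective fun x : NHecke M => (T 1 : ℤ[T;T⁻¹]) • x := by
  intro x y h
  have := congrArg (fun x : NHecke M => (T (-1) : ℤ[T;T⁻¹]) • x) h
  simpa only [smul_smul, ← LaurentPolynomial.T_add, neg_add_cancel, LaurentPolynomial.T_zero,
    one_smul] using this

variable {cs} in
theorem IsCanonicalBasis.repr_Q_sum {c : Module.Basis W ℤ[T;T⁻¹] (NHecke M)}
    {Q p : W → W →₀ ℤ[X]} (_h : cs.IsCanonicalBasis c Q p) (w y : W) :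
    c.repr ((Q w).sum fun y f => Polynomial.toLaurent f • c y) y = Polynomial.toLaurent (Q w y) :=
  c.repr_finsuppSum_smul (Q w) (fun _ f => Polynomial.toLaurent f) (fun _ => map_zero _) y

variable {cs} in
theorem IsCanonicalBasis.sum_eq_sum {c : Module.Basis W ℤ[T;T⁻¹] (NHecke M)}
    {Q p : W → W →₀ ℤ[X]} (h : cs.IsCanonicalBasis c Q p) (w : W) :
    ((Q w).sum fun y f => Polynomial.toLaurent f • c y) =
      (p w).sum fun y f => Polynomial.toLaurent f • cs.nT y := by
  apply T_smul_injective
  have h1 := h.T_eq w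
  have h2 := h.c_eq w
  rw [← sub_eq_iff_eq_add'] at h1
  beta_reduce
  rw [← h1, h2]
  abel

theorem isCanonicalBasis_unique {c c' : Module.Basis W ℤ[T;T⁻¹] (NHecke M)}
    {Q p Q' p' : W → W →₀ ℤ[X]} (h : cs.IsCanonicalBasis c Q p)
    (h' : cs.IsCanonicalBasis c' Q' p') : c = c' ∧ Q = Q' ∧ p = p' := by
  have hc : c = c' := by
    apply Module.Basis.eq_of_apply_eq
    intro w
    rw [h.eq_canon, h'.eq_canon]
  subst hc
  have hp : p = p' := by
    funext w
    ext1 y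
    apply Polynomial.toLaurent_injective
    have h1 := cs.nBasis_repr_c_eq (h.c_eq w) y
    rw [cs.nBasis_repr_c_eq (h'.c_eq w) y, sub_right_inj] at h1
    exact ((LaurentPolynomial.isUnit_T 1).mul_left_cancel h1).symm
  subst hp
  refine ⟨rfl, ?_, rfl⟩
  funext w
  ext1 y
  apply Polynomial.toLaurent_injective
  rw [← h.repr_Q_sum, ← h'.repr_Q_sum, h.sum_eq_sum, h'.sum_eq_sum]

variable {cs} in
/-- The constant terms of `p_{y,w}` and `q_{y,w}` agree. -/
theorem IsCanonicalBasis.coeff_zero_eq {c : Module.Basis W ℤ[T;T⁻¹] (NHecke M)}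
    {Q p : W → W →₀ ℤ[X]} (h : cs.IsCanonicalBasis c Q p) (w y : W) :
    (p w y).coeff 0 = (Q w y).coeff 0 := by
  have h1 := congrArg (fun x => cs.nBasis.repr x y) (h.sum_eq_sum w)
  simp only [cs.nBasis_repr_sum (p w) (fun _ f => Polynomial.toLaurent f) (fun _ => map_zero _)]
    at h1
  -- Every correction in $c_v=T_v-q\sum p_{y,v}T_y$ carries a factor `X`, so it does not reach the
  -- constant term.
  have h2 : ∀ v, cs.nBasis.repr (Polynomial.toLaurent (Q w v) • c v) y =
      Finsupp.single v (Polynomial.toLaurent (Q w v)) y -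
        Polynomial.toLaurent (Polynomial.X * (Q w v * p v y)) := by
    intro v
    rw [map_smul, Finsupp.smul_apply, cs.nBasis_repr_c_eq (h.c_eq v), smul_eq_mul, mul_sub,
      map_mul, map_mul, Polynomial.toLaurent_X, mul_left_comm]
    congr 1
    by_cases hv : v = y
    · simp [hv]
    · simp [Ne.symm hv]
  have h3 : ∑ v ∈ (Q w).support, Finsupp.single v (Polynomial.toLaurent (Q w v)) y =
      Polynomial.toLaurent (Q w y) := by
    rw [Finset.sum_eq_single y]
    · simp
    · intro v _ hv
      rw [Finsupp.single_eq_of_ne hv.symm]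
    · intro hy
      rw [Finsupp.notMem_support_iff.mp hy]
      simp
  rw [Finsupp.sum, map_sum, Finsupp.finsetSum_apply, Finset.sum_congr rfl fun v _ => h2 v,
    Finset.sum_sub_distrib, h3, ← map_sum, ← map_sub] at h1
  rw [← Polynomial.toLaurent_injective h1, Polynomial.coeff_sub, Polynomial.finsetSum_coeff]
  simp

end CoxeterSystem

namespace CoxeterSystem

variable {B W : Type*} [Group W] {M : CoxeterMatrix B} (cs : CoxeterSystem M W)

open LaurentPolynomial (T)

/-! ### Comparison of the two forms of the Hecke algebra -/

theorem prod_map_smul_gen {a b : ℤ[T;T⁻¹]} (ω : List B) :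
    (ω.map fun s => (T 1 : ℤ[T;T⁻¹]) • HeckeAlgebra.gen M a b s).prod =
      (T ω.length : ℤ[T;T⁻¹]) • (ω.map (HeckeAlgebra.gen M a b)).prod := by
  induction ω with
  | nil => simp
  | cons i ω ih =>
    rw [List.map_cons, List.prod_cons, ih, smul_mul_smul_comm, ← LaurentPolynomial.T_add,
      List.map_cons, List.prod_cons, List.length_cons, Nat.cast_succ, add_comm]

variable (M) in
/-- The homomorphism from the traditional to the normalized Hecke algebra with
`T_s ↦ q ^ (1/2) T_s`. -/
def klToN : KLHecke M →ₐ[ℤ[T;T⁻¹]] NHecke M :=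
  RingQuot.liftAlgHom ℤ[T;T⁻¹] (A := FreeAlgebra ℤ[T;T⁻¹] B) ⟨FreeAlgebra.lift ℤ[T;T⁻¹]
      fun s => (T 1 : ℤ[T;T⁻¹]) • HeckeAlgebra.gen M _ _ s, by
    intro x y h
    cases h with
    | quadratic s =>
      rw [map_mul, map_add, map_smul, AlgHom.commutes, FreeAlgebra.lift_ι_apply,
        smul_mul_smul_comm, HeckeAlgebra.gen_mul_gen, map_one, smul_add, smul_smul, smul_smul,
        Algebra.algebraMap_eq_smul_one, mul_sub, sub_mul, one_mul]
      simp only [← LaurentPolynomial.T_add]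
      norm_num
    | braid s s' =>
      rw [map_list_prod, map_list_prod, List.map_map, List.map_map]
      simp only [Function.comp_def, FreeAlgebra.lift_ι_apply]
      rw [prod_map_smul_gen, prod_map_smul_gen, HeckeAlgebra.gen_braid, length_alternatingWord,
        length_alternatingWord, M.symmetric]⟩

theorem klToN_gen (i : B) : klToN M (HeckeAlgebra.gen M _ _ i) =
    (T 1 : ℤ[T;T⁻¹]) • HeckeAlgebra.gen M _ _ i := by
  refine (RingQuot.liftAlgHom_mkAlgHom_apply ℤ[T;T⁻¹] _ _ (FreeAlgebra.ι ℤ[T;T⁻¹] i)).trans ?_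
  rw [FreeAlgebra.lift_ι_apply]

theorem klToN_klT (w : W) :
    klToN M (cs.klT w) = (T (cs.length w) : ℤ[T;T⁻¹]) • cs.nT w := by
  obtain ⟨ω, hω, rfl⟩ := cs.exists_isReduced w
  rw [klT, nT, HeckeAlgebra.stdT_wordProd cs _ _ hω, HeckeAlgebra.stdT_wordProd cs _ _ hω,
    map_list_prod, List.map_map, hω.eq, ← prod_map_smul_gen]
  congr 2
  ext1 i
  exact klToN_gen i

theorem klBar_gen (i : B) : klBar M (HeckeAlgebra.gen M _ _ i) =
    (T (-2) : ℤ[T;T⁻¹]) • (HeckeAlgebra.gen M _ _ i - algebraMap ℤ[T;T⁻¹] _ (T 2 - 1)) := by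
  refine (HeckeAlgebra.bar_gen M _ _ _ _ _ i).trans ?_
  change laurentBar (T 2) • (_ : KLHecke M) = _
  rw [laurentBar_T]

theorem klBar_smul (r : ℤ[T;T⁻¹]) (x : KLHecke M) : klBar M (r • x) = laurentBar r • klBar M x :=
  HeckeAlgebra.bar_smul M _ _ _ _ _ r x

/-- Both composites are multiplicative and semilinear for $v\mapsto v^{-1}$, so it suffices to
compare them on the $T_s$, where both give $v^{-1}(T_s-(v-v^{-1}))$. -/
theorem klToN_klBar (x : KLHecke M) : klToN M (klBar M x) = nBar M (klToN M x) := by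
  induction x using HeckeAlgebra.induction_gen_mul with
  | one => simp only [map_one]
  | add x y hx hy => rw [map_add, map_add, hx, hy, map_add, map_add]
  | smul r x hx => rw [klBar_smul, map_smul, hx, map_smul, nBar_smul]
  | gen_mul i x hx =>
    rw [map_mul, map_mul, hx, map_mul, map_mul, klBar_gen, klToN_gen, map_smul, map_sub, klToN_gen,
      AlgHom.commutes, nBar_smul, nBar_gen, laurentBar_T]
    congr 1
    rw [Algebra.algebraMap_eq_smul_one, Algebra.algebraMap_eq_smul_one, smul_sub, smul_sub,
      smul_smul, smul_smul, smul_smul, mul_sub, mul_sub, mul_one]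
    simp only [← LaurentPolynomial.T_add]
    norm_num

/-- The basis `(T_w)` of the traditional Hecke algebra. -/
abbrev klBasis : Module.Basis W ℤ[T;T⁻¹] (KLHecke M) := HeckeAlgebra.stdBasis cs _ _

theorem klBasis_apply (w : W) : cs.klBasis w = cs.klT w := HeckeAlgebra.stdBasis_apply cs _ _ w

theorem nBasis_repr_klToN (x : KLHecke M) (y : W) :
    cs.nBasis.repr (klToN M x) y = T (cs.length y) * cs.klBasis.repr x y := by
  suffices h : (cs.nBasis.coord y).comp (klToN M).toLinearMap =
      (T (cs.length y) : ℤ[T;T⁻¹]) • cs.klBasis.coord y from LinearMap.congr_fun h x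
  apply cs.klBasis.ext
  intro z
  rw [LinearMap.comp_apply, AlgHom.toLinearMap_apply, klBasis_apply, klToN_klT, map_smul,
    LinearMap.smul_apply, Module.Basis.coord_apply, Module.Basis.coord_apply, nBasis_repr_nT,
    ← klBasis_apply, Module.Basis.repr_self]
  by_cases h : y = z
  · simp [h]
  · simp [h]

theorem klToN_injective : Function.Injective (klToN M) := by
  intro x y h
  -- The statement involves only the matrix, so bases indexed by the group of `M` itself are used.
  apply M.toCoxeterSystem.klBasis.repr.injective
  ext1 w
  have h1 := congrArg (fun x => M.toCoxeterSystem.nBasis.repr x w) h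
  simp only [nBasis_repr_klToN] at h1
  exact (LaurentPolynomial.isUnit_T _).mul_left_cancel h1

/-- The Kazhdan-Lusztig element `C_w` formed with given polynomials. -/
def klElement (P : W → W →₀ ℤ[X]) (w : W) : KLHecke M :=
  (P w).sum fun y f =>
    ((-1) ^ (cs.length w - cs.length y) * T ((cs.length w : ℤ) - 2 * cs.length y) *
      Polynomial.aeval (T (-2) : ℤ[T;T⁻¹]) f) • cs.klT y

theorem repr_klToN_klElement (P : W → W →₀ ℤ[X]) (w y : W) :
    cs.nBasis.repr (klToN M (cs.klElement P w)) y =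
      (-1) ^ (cs.length w - cs.length y) * (T ((cs.length w : ℤ) - cs.length y) *
        Polynomial.aeval (T (-2) : ℤ[T;T⁻¹]) (P w y)) := by
  have h := cs.klBasis.repr_finsuppSum_smul (P w) (fun y f =>
    (-1) ^ (cs.length w - cs.length y) * T ((cs.length w : ℤ) - 2 * cs.length y) *
      Polynomial.aeval (T (-2) : ℤ[T;T⁻¹]) f) (fun _ => by simp) y
  simp only [klBasis_apply] at h
  rw [nBasis_repr_klToN, klElement, h, show (cs.length w : ℤ) - cs.length y =
    cs.length y + ((cs.length w : ℤ) - 2 * cs.length y) by ring, LaurentPolynomial.T_add]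
  ring

theorem _root_.LaurentPolynomial.coeff_neg_one_pow_mul (n : ℕ) (f : ℤ[T;T⁻¹]) (j : ℤ) :
    ((-1) ^ n * f).coeff j = (-1) ^ n * f.coeff j := by
  obtain h | h := neg_one_pow_eq_or ℤ[T;T⁻¹] n <;> obtain ⟨k, rfl | rfl⟩ := Nat.even_or_odd' n <;>
    simp [pow_succ]

open scoped Classical in
theorem nCoeff_klToN_klElement (P : W → W →₀ ℤ[X]) (w y : W) (j : ℤ) :
    cs.nCoeff y j (klToN M (cs.klElement P w)) = (-1) ^ (cs.length w - cs.length y) *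
      if j ≤ cs.length w - cs.length y ∧ Even (j - (cs.length w - cs.length y)) then
        (P w y).coeff ((j - (cs.length w - cs.length y)) / 2).natAbs else 0 := by
  rw [nCoeff_apply, repr_klToN_klElement, LaurentPolynomial.coeff_neg_one_pow_mul,
    LaurentPolynomial.coeff_T_mul, LaurentPolynomial.coeff_aeval_T_neg_two]
  simp only [sub_nonpos]

-- By uniqueness it is enough to see that the image has no exponents $\le0$ apart from the $1$ at
-- $T_w$. The exponents at $T_y$ are $l(w)-l(y)-2k$ with $k\le\deg P_{y,w}$, positive by the degree
-- bound.
variable {cs} in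
theorem IsKLFamily.klToN_klElement {P : W → W →₀ ℤ[X]} (h : cs.IsKLFamily P) (w : W) :
    klToN M (cs.klElement P w) = cs.canon w := by
  classical
  refine IsCanonical.unique (cs := cs) (w := w) ⟨?_, ?_⟩ (cs.isCanonical_canon w)
  · rw [← klToN_klBar]
    exact congrArg _ (h.bar_eq w)
  · intro y j hj
    rw [nCoeff_klToN_klElement]
    by_cases hyw : y = w
    · subst hyw
      rw [h.diag, Polynomial.coeff_one]
      simp only [Int.even_iff, sub_self, tsub_self, pow_zero, one_mul, sub_zero, true_and]
      split_ifs <;> first | rfl | (exfalso; omega)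
    rw [if_neg (fun hc : y = w ∧ j = 0 => hyw hc.1), mul_eq_zero]
    right
    split_ifs with hc
    · by_cases hle : cs.BruhatLE y w
      · have hd := h.degree_le y w ⟨hle, hyw⟩
        obtain ⟨h1, k, hk⟩ := hc
        apply Polynomial.coeff_eq_zero_of_natDegree_lt
        omega
      · rw [h.eq_zero y w hle, Polynomial.coeff_zero]
    · rfl

/-- The Kazhdan-Lusztig polynomial `P_{y,w}`, read off from the coefficients of `c_w`. -/
def klPoly (w y : W) : ℤ[X] :=
  polyOfFn (cs.length w - cs.length y) fun k => (-1) ^ (cs.length w - cs.length y) *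
    cs.nCoeff y ((cs.length w : ℤ) - cs.length y - 2 * k) (cs.canon w)

theorem coeff_klPoly (w y : W) (k : ℕ) :
    (cs.klPoly w y).coeff k = (-1) ^ (cs.length w - cs.length y) *
      cs.nCoeff y ((cs.length w : ℤ) - cs.length y - 2 * k) (cs.canon w) := by
  refine coeff_polyOfFn (fun k hk => ?_) k
  rw [mul_eq_zero]
  right
  by_contra h
  have := (cs.isCanonicalStrong_canon w).nonneg _ _ h
  omega

/-- The Kazhdan-Lusztig polynomials `P_{y,w}` as a finitely supported family in `y`. -/
def klPolyFinsupp (w : W) : W →₀ ℤ[X] :=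
  Finsupp.onFinset (cs.nBasis.repr (cs.canon w)).support (cs.klPoly w) <| by
    intro y hy
    rw [Finsupp.mem_support_iff]
    intro h
    apply hy
    ext k
    rw [coeff_klPoly, nCoeff_apply, h]
    simp

theorem klPolyFinsupp_apply (w y : W) : cs.klPolyFinsupp w y = cs.klPoly w y := rfl

/-- The upper bound and the parity of the exponents in $c_w$ ensure that each has the form
$l(w)-l(y)-2k$ with $k\ge0$, so no coefficient is lost. -/
theorem klToN_klElement_klPolyFinsupp (w : W) :
    klToN M (cs.klElement cs.klPolyFinsupp w) = cs.canon w := by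
  classical
  apply cs.ext_nCoeff
  intro y j
  have hs := cs.isCanonicalStrong_canon w
  rw [nCoeff_klToN_klElement, klPolyFinsupp_apply, coeff_klPoly]
  split_ifs with hc
  · obtain ⟨h1, k, hk⟩ := hc
    rw [← mul_assoc, ← mul_pow, show (-1 : ℤ) * -1 = 1 by norm_num, one_pow, one_mul,
      show (cs.length w : ℤ) - cs.length y -
        2 * (((j - (cs.length w - cs.length y)) / 2).natAbs : ℕ) = j by omega]
  · rw [mul_zero]
    by_contra hne
    apply hc
    refine ⟨hs.le _ _ (Ne.symm hne), ?_⟩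
    have := hs.even _ _ (Ne.symm hne)
    rw [Int.even_iff] at this ⊢
    omega

theorem isKLFamily_klPolyFinsupp : cs.IsKLFamily cs.klPolyFinsupp where
  diag w := by
    ext k
    rw [klPolyFinsupp_apply, coeff_klPoly, Polynomial.coeff_one]
    have hs := cs.isCanonicalStrong_canon w
    split_ifs with hk
    · simp [hk, hs.nCoeff_self]
    · rw [mul_eq_zero]
      right
      by_contra hne
      have := hs.nonneg _ _ hne
      omega
  eq_zero y w h := by
    ext k
    rw [klPolyFinsupp_apply, coeff_klPoly, Polynomial.coeff_zero, mul_eq_zero]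
    right
    by_contra hne
    exact h ((cs.isCanonicalStrong_canon w).bruhatLE _ _ hne)
  degree_le y w h := by
    have hl := h.length_lt
    have hd : (cs.klPolyFinsupp w y).natDegree ≤ (cs.length w - cs.length y - 1) / 2 := by
      rw [Polynomial.natDegree_le_iff_coeff_eq_zero]
      intro k hk
      rw [klPolyFinsupp_apply, coeff_klPoly, mul_eq_zero]
      right
      rw [(cs.isCanonical_canon w).nCoeff_eq y _ (by omega), if_neg (fun hc => h.2 hc.1)]
    omega
  bar_eq w := by
    apply klToN_injective
    change klToN M (klBar M (cs.klElement cs.klPolyFinsupp w)) =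
      klToN M (cs.klElement cs.klPolyFinsupp w)
    rw [klToN_klBar, klToN_klElement_klPolyFinsupp, (cs.isCanonical_canon w).bar_eq]

theorem isKLFamily_unique {P P' : W → W →₀ ℤ[X]} (h : cs.IsKLFamily P) (h' : cs.IsKLFamily P') :
    P = P' := by
  funext w
  ext1 y
  apply LaurentPolynomial.aeval_T_neg_two_injective
  have h1 := congrArg (fun x => cs.nBasis.repr x y)
    ((h.klToN_klElement w).trans (h'.klToN_klElement w).symm)
  simp only [repr_klToN_klElement] at h1
  exact (LaurentPolynomial.isUnit_T _).mul_left_cancel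
    ((isUnit_one.neg.pow _).mul_left_cancel h1)

-- The coefficient of $T_y$ in $c_w$ is $-q\,p_{y,w}$ by definition, and
-- $(-q)^{l(w)-l(y)}P_{y,w}(q^{-2})$ as the image of $C_w$; the unit $-q$ cancels.
variable {cs} in
theorem IsKLFamily.toLaurent_eq {P : W → W →₀ ℤ[X]} (hP : cs.IsKLFamily P)
    {c : Module.Basis W ℤ[T;T⁻¹] (NHecke M)} {Q p : W → W →₀ ℤ[X]}
    (hc : cs.IsCanonicalBasis c Q p) {y w : W} (h : cs.BruhatLT y w) :
    Polynomial.toLaurent (p w y) = (-T 1) ^ (cs.length w - cs.length y - 1) *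
      Polynomial.aeval (T (-2) : ℤ[T;T⁻¹]) (P w y) := by
  have h1 := cs.repr_klToN_klElement P w y
  rw [hP.klToN_klElement, ← hc.eq_canon, cs.nBasis_repr_c_eq (hc.c_eq w),
    Finsupp.single_eq_of_ne h.2, zero_sub] at h1
  have hl := h.length_lt
  obtain ⟨n, hn⟩ : ∃ n, cs.length w = cs.length y + (n + 1) :=
    ⟨cs.length w - cs.length y - 1, by omega⟩
  rw [show (cs.length w : ℤ) - cs.length y = (n + 1 : ℕ) by omega,
    show cs.length w - cs.length y = n + 1 by omega] at h1
  rw [show cs.length w - cs.length y - 1 = n by omega]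
  have hT : (T ((n + 1 : ℕ) : ℤ) : ℤ[T;T⁻¹]) = T 1 ^ (n + 1) := by
    rw [LaurentPolynomial.T_pow, mul_one]
  apply (LaurentPolynomial.isUnit_T (R := ℤ) 1).mul_left_cancel
  rw [← neg_inj, h1, hT, neg_pow (T 1 : ℤ[T;T⁻¹]) n]
  ring

variable {cs} in
theorem IsKLFamily.coeff_eq {P : W → W →₀ ℤ[X]} (hP : cs.IsKLFamily P)
    {c : Module.Basis W ℤ[T;T⁻¹] (NHecke M)} {Q p : W → W →₀ ℤ[X]}
    (hc : cs.IsCanonicalBasis c Q p) {y w : W} (h : cs.BruhatLT y w) :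
    (if Even (cs.length w - cs.length y - 1)
      then (P w y).coeff ((cs.length w - cs.length y - 1) / 2) else 0) =
        (-1) ^ (cs.length w - cs.length y - 1) * (p w y).coeff 0 := by
  classical
  set n := cs.length w - cs.length y - 1 with hn
  have h1 := congrArg (fun f => f.coeff ((0 : ℕ) : ℤ)) (hP.toLaurent_eq hc h)
  simp only [Polynomial.coeff_toLaurent_natCast, ← hn] at h1
  rw [h1, neg_pow (T 1 : ℤ[T;T⁻¹]), LaurentPolynomial.T_pow, mul_one, mul_assoc,
    LaurentPolynomial.coeff_neg_one_pow_mul, LaurentPolynomial.coeff_T_mul,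
    LaurentPolynomial.coeff_aeval_T_neg_two, ← mul_assoc, ← mul_pow,
    show (-1 : ℤ) * -1 = 1 by norm_num, one_pow, one_mul]
  simp only [Int.even_iff, Nat.even_iff]
  split_ifs
  · congr 1
    omega
  · omega
  · omega
  · rfl

end CoxeterSystem

end

/-- For every Coxeter system, the Kazhdan-Lusztig polynomials `P_{y,w} = P w y` and the basis
`c` with its polynomials `q_{y,w} = Q w y`, `p_{y,w} = p w y` exist and are unique, and for
`y < w`, with `μ_{y,w} = (Q w y).coeff 0`, one has
`p_{y,w}(q) = (-q) ^ (ℓ(w) - ℓ(y) - 1) P_{y,w}(q⁻²)`; the constant term of `p_{y,w}` is `μ_{y,w}`;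
and the coefficient of `q ^ ((ℓ(w) - ℓ(y) - 1) / 2)` in `P_{y,w}`, which is `0` if the exponent
is not an integer, is `(-1) ^ (ℓ(w) - ℓ(y) - 1) μ_{y,w}`. -/
theorem mainTheorem7 {B W : Type*} [Group W] {M : CoxeterMatrix B} (cs : CoxeterSystem M W) :
    (∃! P : W → W →₀ ℤ[X], cs.IsKLFamily P) ∧
    (∃! x : Module.Basis W ℤ[T;T⁻¹] (CoxeterSystem.NHecke M) ×
        (W → W →₀ ℤ[X]) × (W → W →₀ ℤ[X]), cs.IsCanonicalBasis x.1 x.2.1 x.2.2) ∧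
    ∀ (P : W → W →₀ ℤ[X]) (c : Module.Basis W ℤ[T;T⁻¹] (CoxeterSystem.NHecke M))
      (Q p : W → W →₀ ℤ[X]), cs.IsKLFamily P → cs.IsCanonicalBasis c Q p →
      ∀ y w : W, cs.BruhatLT y w →
        Polynomial.toLaurent (p w y) =
            (-LaurentPolynomial.T 1) ^ (cs.length w - cs.length y - 1) *
              Polynomial.aeval (LaurentPolynomial.T (-2) : ℤ[T;T⁻¹]) (P w y) ∧
        (p w y).coeff 0 = (Q w y).coeff 0 ∧
        (if Even (cs.length w - cs.length y - 1)
          then (P w y).coeff ((cs.length w - cs.length y - 1) / 2) else 0) =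
            (-1) ^ (cs.length w - cs.length y - 1) * (Q w y).coeff 0 := by
  refine ⟨⟨_, cs.isKLFamily_klPolyFinsupp,
      fun P hP => cs.isKLFamily_unique hP cs.isKLFamily_klPolyFinsupp⟩, ?_, ?_⟩
  · obtain ⟨Q, p, h⟩ := cs.exists_isCanonicalBasis
    refine ⟨⟨cs.canonBasis, Q, p⟩, h, ?_⟩
    rintro ⟨c', Q', p'⟩ h'
    obtain ⟨rfl, rfl, rfl⟩ := cs.isCanonicalBasis_unique h' h
    rfl
  · intro P c Q p hP hc y w h
    refine ⟨hP.toLaurent_eq hc h, hc.coeff_zero_eq w y, ?_⟩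
    rw [hP.coeff_eq hc h, hc.coeff_zero_eq w y]
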